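/- **Setting.** For each index $k\in\mathbb{N}$ let $n=n_k$, $p=p_k$, $s=s_k$ be natural numbers with $1\le s\le p$ and let $\lambda=\lambda_k>0$. Let $z^*\in\{-1,0,1\}^p$ with $\sum_{j}|z_j^*|=s$, and let $\beta^*\in\mathbb{R}^p$ satisfy $\beta^*_j=z^*_j|\beta^*_j|$ for all $j$ and $|\beta^*_j|\ge\lambda$ whenever $z^*_j\ne0$. Observe $X\in\mathbb{R}^{n\times p}$ and $Y=X\beta^*+w$, where all entries of $X$ and of $w\in\mathbb{R}^n$ are i.i.d. $\mathcal N(0,1)$; write $X_j$ for the $j$-th column of $X$. Put $$\mathsf{SNR}=\frac{\lambda\sqrt n}{2}-\frac{\log\frac{p-s}{s}}{\lambda\sqrt n},\qquad t(X_j)=\frac{\lambda}{2}+\frac{\log\frac{p-s}{s}}{\lambda\|X_j\|^2},$$ $$\mu_j(a)=a\|X_j\|\max\{|\beta_j^*|,\lambda\}+\|X_j\|^{-1}\sum_{l\ne j}\beta_l^*X_j^TX_l\quad(a\in\{-1,0,1\}),\qquad \ell(z,z^*)=\sum_{j=1}^p\bigl(\mu_j(z_j)-\mu_j(z_j^*)\bigr)^2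 .$$ Starting from a (possibly data-dependent) $z^{(0)}\in\{-1,0,1\}^p$, and using the same data $(X,Y)$ in every step, for $t\ge1$ let $$\beta^{(t)}\in\operatorname*{argmin}_{\{\beta\in\mathbb{R}^p:\ \beta_j=\beta_j|z^{(t-1)}_j|\ \forall j\}}\|Y-X\beta\|^2,\qquad r^{(t)}_j=\frac{X_j^TY-\sum_{l\neq j}\beta^{(t)}_l X_j^TX_l}{\|X_j\|^2},$$ and let $z^{(t)}_j=1$ if $r^{(t)}_j>t(X_j)$, $z_j^{(t)}=-1$ if $r^{(t)}_j<-t(X_j)$, and $z_j^{(t)}=0$ otherwise. **Theorem.** Assume that, as $k\to\infty$, $\limsup s/p<\tfrac12$, $s(\log p)^4=o(n)$ and $\mathsf{SNR}\to\infty$, and let $C_0>0$ be a constant. Then there is a sequence $\varepsilon_k\to0$, depending only on $C_0$ and the sequences $n_k,p_k,s_k,\lambda_k$, such that for all sufficiently large $k$, for all $z^*$, $\beta^*$ and $z^{(0)}$ as above and every $\eta$: if $$\ell(z^{(0)},z^*)\le C_0\,s\,n\lambda^2\quad\text{with probability at least }1-\eta,$$ then, with probability at least $1-\eta-\exp(-\mathsf{SNR})-2p^{-1}$,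 $$\ell(z^{(t)},z^*)\le s\,n\lambda^2\exp\left(-\frac{(1+\varepsilon_k)\,\mathsf{SNR}^2}{2}\right)+\frac12\,\ell(z^{(t-1)},z^*)\qquad\text{for all }t\ge1 .$$ -/

import Mathlib

open MeasureTheory ProbabilityTheory Filter Topology Asymptotics

namespace SignRecovery

noncomputable section

/-- The sign patterns in `{-1, 0, 1}^p` with exactly `s` nonzero entries: `∑ⱼ |zⱼ| = s`. -/
def signPatterns (p s : ℕ) : Set (Fin p → SignType) :=
  {z | ∑ j, |((z j : SignType) : ℝ)| = (s : ℝ)}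

/-- Coefficient vectors with signs `z` whose nonzero entries have magnitude at least `lam`. -/
def coeffSpace {p : ℕ} (z : Fin p → SignType) (lam : ℝ) : Set (Fin p → ℝ) :=
  {β | (∀ j, β j = ((z j : SignType) : ℝ) * |β j|) ∧ ∀ j, z j ≠ 0 → lam ≤ |β j|}

/-- The signal-to-noise ratio `lam √n / 2 - log ((p - s) / s) / (lam √n)`. -/
def snr (n p s : ℕ) (lam : ℝ) : ℝ :=
  lam * √(n : ℝ) / 2 - Real.log (((p : ℝ) - (s : ℝ)) / (s : ℝ)) / (lam * √(n : ℝ))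

section Model

variable {Ω : Type*} [MeasurableSpace Ω] {n p : ℕ}

/-- The `n p` entries of the design `X` and the `n` entries of the noise `w` are mutually
independent standard normal random variables. -/
structure IsGaussianDesign (P : Measure Ω) (X : Ω → Matrix (Fin n) (Fin p) ℝ)
    (w : Ω → Fin n → ℝ) : Prop where
  law_design : ∀ i j, HasLaw (fun ω => X ω i j) (gaussianReal 0 1) P
  law_noise : ∀ i, HasLaw (fun ω => w ω i) (gaussianReal 0 1) P
  indep : iIndepFun
    (Sum.elim (fun (e : Fin n × Fin p) (ω : Ω) => X ω e.1 e.2) (fun (i : Fin n) (ω : Ω) => w ω i)) P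

end Model

section Algorithm

variable {n p : ℕ}

/-- The response `Y = X β + w`. -/
def response (X : Matrix (Fin n) (Fin p) ℝ) (β : Fin p → ℝ) (w : Fin n → ℝ) : Fin n → ℝ :=
  fun i => (∑ j, X i j * β j) + w i

/-- The inner product `Xⱼᵀ v` of the `j`-th column of `X` with `v`. -/
def colDot (X : Matrix (Fin n) (Fin p) ℝ) (j : Fin p) (v : Fin n → ℝ) : ℝ :=
  ∑ i, X i j * v i

/-- The inner product `Xⱼᵀ Xₗ` of two columns of `X`. -/
def gram (X : Matrix (Fin n) (Fin p) ℝ) (j l : Fin p) : ℝ :=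
  ∑ i, X i j * X i l

/-- The Euclidean norm `‖Xⱼ‖` of the `j`-th column of `X`. -/
def colNorm (X : Matrix (Fin n) (Fin p) ℝ) (j : Fin p) : ℝ :=
  √(∑ i, X i j ^ 2)

/-- The mean `μⱼ(β, a) = a ‖Xⱼ‖ max(|βⱼ|, lam) + ‖Xⱼ‖⁻¹ ∑_{l ≠ j} βₗ Xⱼᵀ Xₗ` of the local
statistic `‖Xⱼ‖⁻¹ Xⱼᵀ Y` under the label `a`. -/
def localMean (lam : ℝ) (X : Matrix (Fin n) (Fin p) ℝ) (β : Fin p → ℝ) (j : Fin p)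
    (a : SignType) : ℝ :=
  (a : ℝ) * colNorm X j * max |β j| lam
    + (colNorm X j)⁻¹ * ∑ l ∈ Finset.univ.erase j, β l * gram X j l

/-- The loss `ℓ(z, z*) = ∑ⱼ |μⱼ(β*, zⱼ) - μⱼ(β*, z*ⱼ)|²`. -/
def loss (lam : ℝ) (X : Matrix (Fin n) (Fin p) ℝ) (β : Fin p → ℝ)
    (z zstar : Fin p → SignType) : ℝ :=
  ∑ j, (localMean lam X β j (z j) - localMean lam X β j (zstar j)) ^ 2

/-- The threshold `t(Xⱼ) = lam / 2 + log ((p - s) / s) / (lam ‖Xⱼ‖²)`. -/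
def threshold (s : ℕ) (lam : ℝ) (X : Matrix (Fin n) (Fin p) ℝ) (j : Fin p) : ℝ :=
  lam / 2 + Real.log (((p : ℝ) - (s : ℝ)) / (s : ℝ)) / (lam * colNorm X j ^ 2)

/-- `b` is a least-squares solution on the support of `z`: it minimizes `‖Y - X β‖²` over the
vectors `β` with `βⱼ = βⱼ |zⱼ|` for all `j`. -/
def IsLeastSquares (X : Matrix (Fin n) (Fin p) ℝ) (Y : Fin n → ℝ) (z : Fin p → SignType)
    (b : Fin p → ℝ) : Prop :=
  b ∈ {β : Fin p → ℝ | ∀ j, β j = β j * |((z j : SignType) : ℝ)|} ∧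
    IsMinOn (fun β : Fin p → ℝ => ∑ i, (Y i - ∑ j, X i j * β j) ^ 2)
      {β : Fin p → ℝ | ∀ j, β j = β j * |((z j : SignType) : ℝ)|} b

/-- The statistic `(Xⱼᵀ Y - ∑_{l ≠ j} bₗ Xⱼᵀ Xₗ) / ‖Xⱼ‖²` that is thresholded. -/
def residualStat (X : Matrix (Fin n) (Fin p) ℝ) (Y : Fin n → ℝ) (b : Fin p → ℝ)
    (j : Fin p) : ℝ :=
  (colDot X j Y - ∑ l ∈ Finset.univ.erase j, b l * gram X j l) / colNorm X j ^ 2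

open Classical in
/-- The thresholding step of the algorithm. -/
def thresholdStep (s : ℕ) (lam : ℝ) (X : Matrix (Fin n) (Fin p) ℝ) (Y : Fin n → ℝ)
    (b : Fin p → ℝ) (j : Fin p) : SignType :=
  if threshold s lam X j < residualStat X Y b j then 1
  else if residualStat X Y b j < -threshold s lam X j then -1
  else 0

/-- `z 0, z 1, z 2, …` is a run of the iterative algorithm on the data `(X, Y)`: each step is a
least-squares fit on the current support (any minimizer, when there are several) followed by
thresholding. -/
def IsRun (s : ℕ) (lam : ℝ) (X : Matrix (Fin n) (Fin p) ℝ) (Y : Fin n → ℝ)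
    (z : ℕ → Fin p → SignType) : Prop :=
  ∀ t : ℕ, 1 ≤ t →
    ∃ b : Fin p → ℝ, IsLeastSquares X Y (z (t - 1)) b ∧ z t = thresholdStep s lam X Y b

end Algorithm

end

end SignRecovery

/-! The iterates depend on the data, so no randomness is left to condition on along a run. The proof
confines all randomness to events that involve only `X`, `w` and the true support `S`; on these
events every step is a deterministic contraction.

Let `b` be the current fit, `β - h` the least-squares fit on `S` (the oracle), and `d = β - h - b`.
By `colNorm_mul_residualStat` the rescaled statistic at `j` is `‖Xⱼ‖ βⱼ + Wⱼ + Fⱼ`. The oracle noise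
`Wⱼ` is linear in `w` with coefficients depending on `X` and `S` alone. The deviation `Fⱼ` is the
off-diagonal Gram matrix applied to `d`, divided by `‖Xⱼ‖`.

Deviation: if `X / √n` is a restricted isometry with constant `α`, then `∑ Fⱼ²` over few coordinates
is of order `α² ‖d‖² n`. The normal equations show that `d` is driven only by coordinates where the
current and true supports differ (`normSq_fit_sub_le`), so `n ‖d‖²` is at most a multiple of `M² ℓ`,
where `M` bounds all `|Wⱼ|`. Coordinates with `|Fⱼ|` above a fraction `δ` of the signal scale then
contribute at most `ℓ / 2` to the new loss. Every other misclassified coordinate must have `|Wⱼ|`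
above a deterministic level, and their total is at most `oracleLoss`, which is the same at all steps
(`loss_thresholdStep_le`). Induction in `forall_loss_le_of_good` keeps the loss in the region where
this applies.

Probability: a net argument with chi-square concentration gives the restricted isometry
(`RestrictedIsometry.of_gridNet`, `net_union_bound`). Given `X`, each `Wⱼ` is Gaussian with standard
deviation at most `1 + 4α` (`noiseDir_sq_le`), so a union bound gives `M² = 16 log p`. These two
events cost `1 / p` each. The conditional mean of `oracleLoss` is about `s n lam² exp(-SNR² / 2)`
(`sum_oracle_tail_le`), and Markov's inequality costs `exp(-SNR)`.

The loss of precision is governed by `γ = 10 (α + δ)`. The argument needs `γ log p → 0` together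
with `α² log p ≪ δ²`, where `α² ≍ s log p / n`; both can be met when `s (log p)⁴ = o(n)`. -/

namespace SignRecovery

open Matrix

/-! ### Restricted isometry and the off-diagonal Gram matrix. -/

section NearIsometry

variable {n p : ℕ}

/-- `X / √n` is an isometry up to a relative error `α` on the vectors supported on `D`. -/
def IsNearIsometryOn (X : Matrix (Fin n) (Fin p) ℝ) (α : ℝ) (D : Finset (Fin p)) : Prop :=
  ∀ u : Fin p → ℝ, (∀ j, j ∉ D → u j = 0) →
    |X *ᵥ u ⬝ᵥ X *ᵥ u - n * (u ⬝ᵥ u)| ≤ n * α * (u ⬝ᵥ u)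

/-- The restricted isometry property of order `m` with constant `α` of `X / √n`. -/
def RestrictedIsometry (X : Matrix (Fin n) (Fin p) ℝ) (m : ℕ) (α : ℝ) : Prop :=
  ∀ D : Finset (Fin p), D.card ≤ m → IsNearIsometryOn X α D

lemma dotProduct_self_nonneg' {ι : Type*} [Fintype ι] (u : ι → ℝ) : 0 ≤ u ⬝ᵥ u :=
  Finset.sum_nonneg fun i _ => mul_self_nonneg (u i)

lemma sq_dotProduct_le {ι : Type*} [Fintype ι] (u v : ι → ℝ) :
    (u ⬝ᵥ v) ^ 2 ≤ (u ⬝ᵥ u) * (v ⬝ᵥ v) := by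
  have := Finset.sum_mul_sq_le_sq_mul_sq Finset.univ u v
  simpa [dotProduct, sq] using this

lemma sq_le_of_forall_quadratic {a b c : ℝ} (h : ∀ t : ℝ, 0 ≤ a * (t * t) + 2 * b * t + c) :
    b ^ 2 ≤ a * c := by
  have := discrim_le_zero (a := a) (b := 2 * b) (c := c) h
  unfold discrim at this
  nlinarith

/-- Polarization: the lower bound at `u + t v` and the upper bound at `u - t v` differ by a
quadratic in `t` that is nonnegative everywhere, and its discriminant gives the estimate. -/
lemma IsNearIsometryOn.sq_bilin_le {X : Matrix (Fin n) (Fin p) ℝ} {α : ℝ} {D : Finset (Fin p)}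
    (h : IsNearIsometryOn X α D) {u v : Fin p → ℝ}
    (hu : ∀ j, j ∉ D → u j = 0) (hv : ∀ j, j ∉ D → v j = 0) :
    (X *ᵥ u ⬝ᵥ X *ᵥ v - n * (u ⬝ᵥ v)) ^ 2 ≤ (n * α) ^ 2 * ((u ⬝ᵥ u) * (v ⬝ᵥ v)) := by
  have key : ∀ t : ℝ, 0 ≤ (n * α * (v ⬝ᵥ v)) * (t * t)
      + 2 * (X *ᵥ u ⬝ᵥ X *ᵥ v - n * (u ⬝ᵥ v)) * t + n * α * (u ⬝ᵥ u) := by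
    intro t
    have h1 := h (u + t • v) (fun j hj => by simp [hu j hj, hv j hj])
    have h2 := h (u - t • v) (fun j hj => by simp [hu j hj, hv j hj])
    have e1 := dotProduct_comm v u
    have e2 := dotProduct_comm (X *ᵥ v) (X *ᵥ u)
    simp only [mulVec_add, mulVec_sub, mulVec_smul, add_dotProduct, dotProduct_add, sub_dotProduct,
      dotProduct_sub, smul_dotProduct, dotProduct_smul, smul_eq_mul, e1, e2] at h1 h2
    have h1' := (abs_le.1 h1).1
    have h2' := (abs_le.1 h2).2
    nlinarith
  have := sq_le_of_forall_quadratic key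
  nlinarith

lemma gram_comm (X : Matrix (Fin n) (Fin p) ℝ) (j l : Fin p) : gram X j l = gram X l j := by
  simp [gram, mul_comm]

lemma mulVec_dotProduct_mulVec (X : Matrix (Fin n) (Fin p) ℝ) (v u : Fin p → ℝ) :
    X *ᵥ v ⬝ᵥ X *ᵥ u = ∑ j, v j * ∑ l, u l * gram X j l := by
  simp only [dotProduct, mulVec, gram, Finset.sum_mul_sum]
  simp only [Finset.mul_sum]
  rw [Finset.sum_comm]
  refine Finset.sum_congr rfl fun j _ => ?_
  rw [Finset.sum_comm]
  refine Finset.sum_congr rfl fun l _ => Finset.sum_congr rfl fun i _ => ?_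
  ring

lemma colDot_mulVec (X : Matrix (Fin n) (Fin p) ℝ) (j : Fin p) (u : Fin p → ℝ) :
    colDot X j (X *ᵥ u) = ∑ l, u l * gram X j l := by
  simp only [colDot, dotProduct, mulVec, gram, Finset.mul_sum]
  rw [Finset.sum_comm]
  refine Finset.sum_congr rfl fun j _ => Finset.sum_congr rfl fun i _ => ?_
  ring

lemma colNorm_sq (X : Matrix (Fin n) (Fin p) ℝ) (j : Fin p) : colNorm X j ^ 2 = gram X j j := by
  rw [colNorm, Real.sq_sqrt (Finset.sum_nonneg fun i _ => sq_nonneg _)]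
  simp [gram, sq]

lemma IsNearIsometryOn.abs_gram_self_sub_le {X : Matrix (Fin n) (Fin p) ℝ} {α : ℝ}
    {D : Finset (Fin p)} (h : IsNearIsometryOn X α D) {j : Fin p} (hj : j ∈ D) :
    |gram X j j - n| ≤ n * α := by
  have := h (Pi.single j 1) (fun l hl => Pi.single_eq_of_ne (by rintro rfl; exact hl hj) _)
  rw [mulVec_dotProduct_mulVec] at this
  simpa [Pi.single_apply, dotProduct] using this

lemma sum_erase_gram (X : Matrix (Fin n) (Fin p) ℝ) (j : Fin p) (d : Fin p → ℝ) :
    ∑ l ∈ Finset.univ.erase j, d l * gram X j l = ∑ l, d l * gram X j l - d j * gram X j j := by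
  rw [← Finset.add_sum_erase _ _ (Finset.mem_univ j)]; ring

/-- The off-diagonal part of the Gram matrix is small on a set of coordinates on which `X / √n` is
nearly an isometry. -/
lemma IsNearIsometryOn.sum_sq_offDiag_le {X : Matrix (Fin n) (Fin p) ℝ} {α : ℝ}
    {D : Finset (Fin p)} (h : IsNearIsometryOn X α D) {T : Finset (Fin p)} (hT : T ⊆ D)
    {d : Fin p → ℝ} (hd : ∀ j, j ∉ D → d j = 0) :
    ∑ j ∈ T, (∑ l ∈ Finset.univ.erase j, d l * gram X j l) ^ 2
      ≤ 4 * (n * α) ^ 2 * (d ⬝ᵥ d) := by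
  classical
  set y : Fin p → ℝ := fun j => ∑ l ∈ Finset.univ.erase j, d l * gram X j l with hy
  set v : Fin p → ℝ := fun j => if j ∈ T then y j else 0 with hv
  have hvD : ∀ j, j ∉ D → v j = 0 := fun j hj => if_neg fun h' => hj (hT h')
  have hvv : v ⬝ᵥ v = ∑ j ∈ T, y j ^ 2 := by
    simp [dotProduct, hv, sq, Finset.sum_ite_mem, ← ite_and]
  have h1 := h.sq_bilin_le hvD hd
  -- Duality: `v` is tested against the row sums that define it. The bracket is the isometry error
  -- of the full Gram matrix, and the last sum corrects for its diagonal not being exactly `n`. Each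
  -- is at most `n α ‖v‖ ‖d‖`, whence the factor 4 after squaring.
  have hdec : v ⬝ᵥ v = (X *ᵥ v ⬝ᵥ X *ᵥ d - n * (v ⬝ᵥ d))
      + ∑ j, v j * (d j * (n - gram X j j)) := by
    rw [mulVec_dotProduct_mulVec]
    simp only [dotProduct, Finset.mul_sum]
    rw [← Finset.sum_sub_distrib, ← Finset.sum_add_distrib]
    refine Finset.sum_congr rfl fun j _ => ?_
    have : v j * v j = v j * y j := by by_cases hj : j ∈ T <;> simp [hv, hj]
    rw [this, hy]
    simp only
    rw [sum_erase_gram, mul_sub, Finset.mul_sum]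
    ring
  have h2 : (∑ j, v j * (d j * (n - gram X j j))) ^ 2
      ≤ (n * α) ^ 2 * ((v ⬝ᵥ v) * (d ⬝ᵥ d)) := by
    refine (Finset.sum_mul_sq_le_sq_mul_sq _ _ _).trans ?_
    have : ∑ j, (d j * (n - gram X j j)) ^ 2 ≤ (n * α) ^ 2 * (d ⬝ᵥ d) := by
      rw [dotProduct, Finset.mul_sum]
      refine Finset.sum_le_sum fun j _ => ?_
      by_cases hj : j ∈ D
      · have := h.abs_gram_self_sub_le hj
        have h3 : (n - gram X j j) ^ 2 ≤ (n * α) ^ 2 := by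
          rw [← neg_sub, neg_sq]; exact sq_le_sq' (by linarith [(abs_le.1 this).1]) (abs_le.1 this).2
        nlinarith [mul_le_mul_of_nonneg_left h3 (sq_nonneg (d j))]
      · simp [hd j hj]
    have hvv' : ∑ j, v j ^ 2 = v ⬝ᵥ v := by simp [dotProduct, sq]
    rw [hvv']
    nlinarith [mul_le_mul_of_nonneg_left this (dotProduct_self_nonneg' v)]
  have h3 : (v ⬝ᵥ v) ^ 2 ≤ 4 * (n * α) ^ 2 * ((v ⬝ᵥ v) * (d ⬝ᵥ d)) := by
    nth_rewrite 1 [hdec]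
    nlinarith [sq_nonneg ((X *ᵥ v ⬝ᵥ X *ᵥ d - n * (v ⬝ᵥ d))
      - ∑ j, v j * (d j * (n - gram X j j)))]
  rw [← hvv]
  rcases (dotProduct_self_nonneg' v).eq_or_lt with h0 | h0
  · rw [← h0]; have := dotProduct_self_nonneg' d; positivity
  · refine le_of_mul_le_mul_left ?_ h0
    nlinarith

end NearIsometry

/-! ### Normal equations. -/

section LeastSquares

variable {n p : ℕ}

/-- Along the `j`-th coordinate direction the change of the squared residual is a quadratic in the
step without constant term; minimality makes it nonnegative, so its linear coefficient vanishes.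
Uniqueness of the minimizer plays no role. -/
lemma IsLeastSquares.normal_equation {X : Matrix (Fin n) (Fin p) ℝ} {Y : Fin n → ℝ}
    {z : Fin p → SignType} {b : Fin p → ℝ} (h : IsLeastSquares X Y z b) {j : Fin p}
    (hj : z j ≠ 0) : colDot X j (Y - X *ᵥ b) = 0 := by
  have hz : |((z j : SignType) : ℝ)| = 1 := by
    rcases hz : z j with _ | _ | _ <;> simp_all
  have key : ∀ t : ℝ, 0 ≤ gram X j j * (t * t) + 2 * (-colDot X j (Y - X *ᵥ b)) * t + 0 := by
    intro t
    have hmem : b + t • (Pi.single j 1 : Fin p → ℝ) ∈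
        {β : Fin p → ℝ | ∀ j, β j = β j * |((z j : SignType) : ℝ)|} := by
      intro l
      by_cases hl : l = j
      · subst hl; simp [hz]
      · have := h.1 l
        simpa [hl] using this
    have h1 : ∑ i, (Y i - ∑ l, X i l * b l) ^ 2
        ≤ ∑ i, (Y i - ∑ l, X i l * (b + t • (Pi.single j 1 : Fin p → ℝ)) l) ^ 2 := h.2 hmem
    have e : ∀ i, Y i - ∑ l, X i l * (b + t • (Pi.single j 1 : Fin p → ℝ)) l
        = (Y - X *ᵥ b) i - t * X i j := by
      intro i
      simp [mulVec, dotProduct, mul_add, Finset.sum_add_distrib, Pi.single_apply]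
      ring
    have e' : ∀ i, Y i - ∑ l, X i l * b l = (Y - X *ᵥ b) i := fun i => rfl
    simp only [e, e'] at h1
    have : ∑ i, ((Y - X *ᵥ b) i - t * X i j) ^ 2 = ∑ i, ((Y - X *ᵥ b) i) ^ 2
        + (gram X j j * (t * t) + 2 * (-colDot X j (Y - X *ᵥ b)) * t) := by
      simp only [gram, colDot, ← Finset.sum_neg_distrib, Finset.mul_sum, Finset.sum_mul,
        ← Finset.sum_add_distrib]
      exact Finset.sum_congr rfl fun i _ => by ring
    linarith
  have := sq_le_of_forall_quadratic key
  nlinarith [sq_nonneg (colDot X j (Y - X *ᵥ b))]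

lemma IsLeastSquares.eq_zero {X : Matrix (Fin n) (Fin p) ℝ} {Y : Fin n → ℝ}
    {z : Fin p → SignType} {b : Fin p → ℝ} (h : IsLeastSquares X Y z b) {j : Fin p}
    (hj : z j = 0) : b j = 0 := by
  have := h.1 j
  simpa [hj] using this

lemma response_eq (X : Matrix (Fin n) (Fin p) ℝ) (β : Fin p → ℝ) (w : Fin n → ℝ) :
    response X β w = X *ᵥ β + w := rfl

end LeastSquares

/-! ### The oracle fit on the true support and the direction of its noise. -/

section Oracle

variable {n p : ℕ}

open Classical in
/-- The Gram matrix of the columns in `S`, completed by the identity on the other coordinates. -/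
noncomputable def maskedGram (X : Matrix (Fin n) (Fin p) ℝ) (S : Finset (Fin p)) :
    Matrix (Fin p) (Fin p) ℝ :=
  fun j l => if j ∈ S then (if l ∈ S then gram X j l else 0) else (if j = l then 1 else 0)

open Classical in
/-- The inner products of the `j`-th column with the other columns in `S`. -/
noncomputable def maskedRow (X : Matrix (Fin n) (Fin p) ℝ) (S : Finset (Fin p)) (j : Fin p) :
    Fin p → ℝ :=
  fun l => if l ∈ S.erase j then gram X j l else 0

/-- The regression coefficients of the off-diagonal part of the `j`-th column on `S`. -/
noncomputable def maskedRegression (X : Matrix (Fin n) (Fin p) ℝ) (S : Finset (Fin p))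
    (j : Fin p) : Fin p → ℝ :=
  (maskedGram X S)⁻¹ *ᵥ maskedRow X S j

open Classical in
/-- The error `β - b` of the least-squares fit `b` on the true support `S` with noise `w`. -/
noncomputable def oracleError (X : Matrix (Fin n) (Fin p) ℝ) (S : Finset (Fin p))
    (w : Fin n → ℝ) : Fin p → ℝ :=
  (maskedGram X S)⁻¹ *ᵥ fun l => if l ∈ S then -colDot X l w else 0

/-- The direction of the noise that enters the `j`-th statistic of the oracle fit on `S`. -/
noncomputable def noiseDir (X : Matrix (Fin n) (Fin p) ℝ) (S : Finset (Fin p)) (j : Fin p) :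
    Fin n → ℝ :=
  fun i => (colNorm X j)⁻¹ * (X i j - (X *ᵥ maskedRegression X S j) i)

lemma maskedGram_mulVec_of_mem (X : Matrix (Fin n) (Fin p) ℝ) {S : Finset (Fin p)} {u : Fin p → ℝ}
    (hu : ∀ j, j ∉ S → u j = 0) {j : Fin p} (hj : j ∈ S) :
    (maskedGram X S *ᵥ u) j = ∑ l, u l * gram X j l := by
  simp only [mulVec, dotProduct, maskedGram, hj, if_true]
  refine Finset.sum_congr rfl fun l _ => ?_
  by_cases hl : l ∈ S
  · simp [hl, mul_comm]
  · simp [hu l hl]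

lemma maskedGram_mulVec_of_notMem (X : Matrix (Fin n) (Fin p) ℝ) {S : Finset (Fin p)}
    (u : Fin p → ℝ) {j : Fin p} (hj : j ∉ S) : (maskedGram X S *ᵥ u) j = u j := by
  simp [mulVec, dotProduct, maskedGram, hj]

lemma IsNearIsometryOn.le_normSq {X : Matrix (Fin n) (Fin p) ℝ} {α : ℝ} {S : Finset (Fin p)}
    (h : IsNearIsometryOn X α S) {u : Fin p → ℝ} (hu : ∀ j, j ∉ S → u j = 0) :
    n * (1 - α) * (u ⬝ᵥ u) ≤ X *ᵥ u ⬝ᵥ X *ᵥ u := by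
  have := (abs_le.1 (h u hu)).1
  linarith

lemma IsNearIsometryOn.normSq_le {X : Matrix (Fin n) (Fin p) ℝ} {α : ℝ} {S : Finset (Fin p)}
    (h : IsNearIsometryOn X α S) {u : Fin p → ℝ} (hu : ∀ j, j ∉ S → u j = 0) :
    X *ᵥ u ⬝ᵥ X *ᵥ u ≤ n * (1 + α) * (u ⬝ᵥ u) := by
  have := (abs_le.1 (h u hu)).2
  linarith

/-- A kernel vector vanishes off `S` because of the identity block, and then `X u = 0`, which the
lower isometry bound allows only for `u = 0`. -/
lemma IsNearIsometryOn.det_maskedGram_ne_zero {X : Matrix (Fin n) (Fin p) ℝ} {α : ℝ}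
    {S : Finset (Fin p)} (h : IsNearIsometryOn X α S) (hn : 0 < n) (hα : α < 1) :
    (maskedGram X S).det ≠ 0 := by
  intro h0
  obtain ⟨u, hu0, hu⟩ := Matrix.exists_mulVec_eq_zero_iff.2 h0
  have hoff : ∀ j, j ∉ S → u j = 0 := fun j hj => by
    rw [← maskedGram_mulVec_of_notMem X u hj, hu]; rfl
  have hz : X *ᵥ u ⬝ᵥ X *ᵥ u = 0 := by
    rw [mulVec_dotProduct_mulVec]
    refine Finset.sum_eq_zero fun j _ => ?_
    by_cases hj : j ∈ S
    · rw [← maskedGram_mulVec_of_mem X hoff hj, hu]; simp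
    · simp [hoff j hj]
  have h1 := h.le_normSq hoff
  rw [hz] at h1
  have hn' : (0 : ℝ) < n := by exact_mod_cast hn
  have h2 : 0 < n * (1 - α) := mul_pos hn' (by linarith)
  have h3 : u ⬝ᵥ u = 0 := by
    refine le_antisymm ?_ (dotProduct_self_nonneg' u)
    by_contra h4
    push Not at h4
    nlinarith [mul_pos h2 h4]
  exact hu0 (dotProduct_self_eq_zero.1 h3)

lemma maskedGram_solve {X : Matrix (Fin n) (Fin p) ℝ} {S : Finset (Fin p)}
    (hdet : (maskedGram X S).det ≠ 0) {y : Fin p → ℝ} (hy : ∀ j, j ∉ S → y j = 0) :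
    (∀ j, j ∉ S → ((maskedGram X S)⁻¹ *ᵥ y) j = 0) ∧
      ∀ j ∈ S, ∑ l, ((maskedGram X S)⁻¹ *ᵥ y) l * gram X j l = y j := by
  have hK : maskedGram X S *ᵥ ((maskedGram X S)⁻¹ *ᵥ y) = y := by
    rw [mulVec_mulVec, Matrix.mul_nonsing_inv _ (isUnit_iff_ne_zero.2 hdet), one_mulVec]
  have hoff : ∀ j, j ∉ S → ((maskedGram X S)⁻¹ *ᵥ y) j = 0 := fun j hj => by
    rw [← maskedGram_mulVec_of_notMem X ((maskedGram X S)⁻¹ *ᵥ y) hj, hK, hy j hj]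
  refine ⟨hoff, fun j hj => ?_⟩
  rw [← maskedGram_mulVec_of_mem X hoff hj, hK]

lemma oracleError_spec {X : Matrix (Fin n) (Fin p) ℝ} {S : Finset (Fin p)}
    (hdet : (maskedGram X S).det ≠ 0) (w : Fin n → ℝ) :
    (∀ j, j ∉ S → oracleError X S w j = 0) ∧
      ∀ j ∈ S, colDot X j w + ∑ l, oracleError X S w l * gram X j l = 0 := by
  classical
  obtain ⟨h1, h2⟩ := maskedGram_solve hdet (y := fun l => if l ∈ S then -colDot X l w else 0)
    (fun j hj => if_neg hj)
  refine ⟨h1, fun j hj => ?_⟩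
  have := h2 j hj
  simp only [hj, if_true] at this
  unfold oracleError
  linarith

lemma maskedRow_of_notMem (X : Matrix (Fin n) (Fin p) ℝ) {S : Finset (Fin p)} (j : Fin p)
    (l : Fin p) (hl : l ∉ S) : maskedRow X S j l = 0 :=
  if_neg fun h => hl (Finset.mem_of_mem_erase h)

lemma maskedRegression_spec {X : Matrix (Fin n) (Fin p) ℝ} {S : Finset (Fin p)}
    (hdet : (maskedGram X S).det ≠ 0) (j : Fin p) :
    (∀ l, l ∉ S → maskedRegression X S j l = 0) ∧
      ∀ l ∈ S, ∑ r, maskedRegression X S j r * gram X l r = maskedRow X S j l :=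
  maskedGram_solve hdet (maskedRow_of_notMem X j)

lemma mulVec_dotProduct_eq_sum_colDot (X : Matrix (Fin n) (Fin p) ℝ) (u : Fin p → ℝ)
    (w : Fin n → ℝ) : X *ᵥ u ⬝ᵥ w = ∑ l, u l * colDot X l w := by
  simp only [dotProduct, mulVec, colDot, Finset.sum_mul, Finset.mul_sum]
  rw [Finset.sum_comm]
  exact Finset.sum_congr rfl fun l _ => Finset.sum_congr rfl fun i _ => by ring

/-- The oracle statistic is the projection of the noise on `noiseDir`. -/
lemma colNorm_mul_noiseDir {X : Matrix (Fin n) (Fin p) ℝ} {S : Finset (Fin p)}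
    (hdet : (maskedGram X S).det ≠ 0) {j : Fin p} (hj : colNorm X j ≠ 0) (w : Fin n → ℝ) :
    colNorm X j * (noiseDir X S j ⬝ᵥ w)
      = colDot X j w + ∑ l ∈ Finset.univ.erase j, oracleError X S w l * gram X j l := by
  classical
  set q := maskedRegression X S j with hq
  set h := oracleError X S w with hh
  obtain ⟨q1, q2⟩ := maskedRegression_spec hdet j
  obtain ⟨h1, h2⟩ := oracleError_spec hdet w
  have e1 : colNorm X j * (noiseDir X S j ⬝ᵥ w) = colDot X j w - X *ᵥ q ⬝ᵥ w := by
    simp only [noiseDir, dotProduct, colDot, Finset.mul_sum, ← Finset.sum_sub_distrib]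
    refine Finset.sum_congr rfl fun i _ => ?_
    rw [← hq]
    field_simp
  -- Symmetry of the Gram matrix moves its inverse from the noise to the row: `h` solves the system
  -- with right side `-Xᵀ w` and `q` the one with the masked row. The coordinate `j` drops out since
  -- the masked row vanishes there if `j ∈ S`, and `h j = 0` otherwise.
  have e2 : X *ᵥ q ⬝ᵥ w = -(X *ᵥ q ⬝ᵥ X *ᵥ h) := by
    rw [mulVec_dotProduct_eq_sum_colDot, mulVec_dotProduct_mulVec, ← Finset.sum_neg_distrib]
    refine Finset.sum_congr rfl fun l _ => ?_
    by_cases hl : l ∈ S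
    · rw [eq_neg_of_add_eq_zero_left (h2 l hl)]; ring
    · rw [hq, q1 l hl]; ring
  have e3 : X *ᵥ q ⬝ᵥ X *ᵥ h = ∑ l ∈ Finset.univ.erase j, h l * gram X j l := by
    rw [dotProduct_comm, mulVec_dotProduct_mulVec, ← Finset.add_sum_erase _ _ (Finset.mem_univ j)]
    have hj0 : h j * ∑ l, q l * gram X j l = 0 := by
      by_cases hjS : j ∈ S
      · rw [hq, q2 j hjS]; simp [maskedRow]
      · rw [hh, h1 j hjS]; ring
    rw [hj0, zero_add]
    refine Finset.sum_congr rfl fun l hl => ?_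
    by_cases hlS : l ∈ S
    · rw [hq, q2 l hlS]
      simp [maskedRow, hlS, Finset.ne_of_mem_erase hl]
    · rw [hh, h1 l hlS]; ring
  rw [e1, e2, e3]; ring

/-- The masked row is the off-diagonal Gram matrix applied to the `j`-th unit vector. -/
lemma IsNearIsometryOn.maskedRow_sq_le {X : Matrix (Fin n) (Fin p) ℝ} {α : ℝ}
    {S : Finset (Fin p)} {j : Fin p} (h : IsNearIsometryOn X α (insert j S)) :
    maskedRow X S j ⬝ᵥ maskedRow X S j ≤ 4 * (n * α) ^ 2 := by
  classical
  have := h.sum_sq_offDiag_le (T := S.erase j)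
    ((Finset.erase_subset _ _).trans (Finset.subset_insert _ _)) (d := Pi.single j 1)
    (fun l hl => Pi.single_eq_of_ne (by rintro rfl; exact hl (Finset.mem_insert_self _ _)) _)
  have e : (Pi.single j 1 : Fin p → ℝ) ⬝ᵥ Pi.single j 1 = 1 := by simp
  rw [e, mul_one] at this
  refine le_trans (le_of_eq ?_) this
  simp only [dotProduct, maskedRow, ← sq]
  rw [← Finset.sum_subset (Finset.subset_univ (S.erase j))]
  · refine Finset.sum_congr rfl fun l hl => ?_
    rw [if_pos hl, sum_erase_gram]
    have := Finset.ne_of_mem_erase hl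
    simp [Pi.single_apply, this, gram_comm X l j]
  · intro l _ hl
    simp [hl]

lemma RestrictedIsometry.colNorm_sq_bounds {X : Matrix (Fin n) (Fin p) ℝ} {α : ℝ} {m : ℕ}
    (h : RestrictedIsometry X m α) (hm : 1 ≤ m) (j : Fin p) :
    n * (1 - α) ≤ colNorm X j ^ 2 ∧ colNorm X j ^ 2 ≤ n * (1 + α) := by
  have := (h {j} (by simpa using hm)).abs_gram_self_sub_le (Finset.mem_singleton_self j)
  rw [colNorm_sq]
  constructor <;> linarith [(abs_le.1 this).1, (abs_le.1 this).2]

/-- This bounds the conditional variance of the oracle noise. The direction is `(Xⱼ - X q) / ‖Xⱼ‖`,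
and `‖X q‖ ≤ 4 α ‖Xⱼ‖` because `X q` only accounts for the small inner products of `Xⱼ` with other
columns. -/
lemma noiseDir_sq_le {X : Matrix (Fin n) (Fin p) ℝ} {α : ℝ} {S : Finset (Fin p)} {m : ℕ}
    (h : RestrictedIsometry X m α) (hn : 0 < n) (hα0 : 0 ≤ α) (hα : α ≤ 1 / 2)
    (hS : S.card + 1 ≤ m) (j : Fin p) :
    noiseDir X S j ⬝ᵥ noiseDir X S j ≤ (1 + 4 * α) ^ 2 := by
  classical
  have hn' : (0 : ℝ) < n := by exact_mod_cast hn
  have hI : IsNearIsometryOn X α (insert j S) := h _ ((Finset.card_insert_le _ _).trans hS)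
  have hIS : IsNearIsometryOn X α S := h _ (by omega)
  have hdet := hIS.det_maskedGram_ne_zero hn (by linarith)
  obtain ⟨q1, q2⟩ := maskedRegression_spec hdet j
  set q := maskedRegression X S j with hq
  set V := X *ᵥ q ⬝ᵥ X *ᵥ q with hV
  have hcn := (h.colNorm_sq_bounds (by omega) j).1
  have hN : n / 2 ≤ colNorm X j ^ 2 := by nlinarith
  have hNpos : 0 < colNorm X j ^ 2 := by linarith
  have e1 : V = q ⬝ᵥ maskedRow X S j := by
    rw [hV, mulVec_dotProduct_mulVec]
    refine Finset.sum_congr rfl fun l _ => ?_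
    by_cases hl : l ∈ S
    · rw [q2 l hl]
    · rw [q1 l hl]; ring
  have h1 : V ^ 2 ≤ (q ⬝ᵥ q) * (4 * (n * α) ^ 2) := by
    rw [e1]
    exact (sq_dotProduct_le _ _).trans
      (mul_le_mul_of_nonneg_left hI.maskedRow_sq_le (dotProduct_self_nonneg' q))
  have h2 := hIS.le_normSq q1
  have h2' : n / 2 * (q ⬝ᵥ q) ≤ V := by
    refine le_trans ?_ h2
    have := dotProduct_self_nonneg' q
    have : n / 2 ≤ n * (1 - α) := by nlinarith
    gcongr
  have hV0 : 0 ≤ V := dotProduct_self_nonneg' _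
  -- Cauchy-Schwarz bounds `V²` by `‖q‖²` times `4 (n α)²`, and `‖q‖² ≤ 2 V / n`; one factor `V`
  -- cancels.
  have h3 : V ≤ 8 * n * α ^ 2 := by
    rcases hV0.eq_or_lt with h0 | h0
    · rw [← h0]; positivity
    · refine le_of_mul_le_mul_left ?_ h0
      have : (q ⬝ᵥ q) * (4 * (n * α) ^ 2) = n / 2 * (q ⬝ᵥ q) * (8 * n * α ^ 2) := by ring
      rw [this] at h1
      have h5 : n / 2 * (q ⬝ᵥ q) * (8 * n * α ^ 2) ≤ V * (8 * n * α ^ 2) := by gcongr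
      nlinarith
  have h4 : V ≤ 16 * α ^ 2 * colNorm X j ^ 2 := by nlinarith [sq_nonneg α]
  set x : Fin n → ℝ := fun i => X i j with hx
  have hxx : x ⬝ᵥ x = colNorm X j ^ 2 := by rw [colNorm_sq]; rfl
  have hcross : |x ⬝ᵥ X *ᵥ q| ≤ 4 * α * colNorm X j ^ 2 := by
    refine abs_le_of_sq_le_sq ?_ (by positivity)
    refine (sq_dotProduct_le _ _).trans ?_
    rw [hxx, ← hV]
    nlinarith
  have e2 : noiseDir X S j ⬝ᵥ noiseDir X S j
      = (colNorm X j ^ 2)⁻¹ * (x ⬝ᵥ x - 2 * (x ⬝ᵥ X *ᵥ q) + V) := by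
    simp only [noiseDir, dotProduct, hV, ← hq, Finset.mul_sum, ← Finset.sum_sub_distrib,
      ← Finset.sum_add_distrib]
    refine Finset.sum_congr rfl fun i _ => ?_
    have e : (colNorm X j ^ 2)⁻¹ = (colNorm X j)⁻¹ ^ 2 := (inv_pow _ _).symm
    simp only [e, hx]
    ring
  rw [e2, inv_mul_le_iff₀ hNpos, hxx]
  nlinarith [(abs_le.1 hcross).1]

end Oracle

/-! ### Distance of the current fit to the oracle fit, and what a misclassification requires of the
noise. -/

section Step

variable {n p : ℕ}

/-- The support of a sign pattern. -/
def signSupport (z : Fin p → SignType) : Finset (Fin p) := Finset.univ.filter fun j => z j ≠ 0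

lemma mem_signSupport {z : Fin p → SignType} {j : Fin p} : j ∈ signSupport z ↔ z j ≠ 0 := by
  simp [signSupport]

lemma card_signSupport {s : ℕ} {z : Fin p → SignType} (hz : z ∈ signPatterns p s) :
    (signSupport z).card = s := by
  have h : ∑ j, |((z j : SignType) : ℝ)| = (s : ℝ) := hz
  have e : ∀ j, |((z j : SignType) : ℝ)| = if z j ≠ 0 then 1 else 0 := by
    intro j
    rcases hz : z j with _ | _ | _ <;> simp
  simp only [e, Finset.sum_boole] at h
  exact_mod_cast h

/-- The coordinates that belong to exactly one of the supports of `z` and `z'`. -/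
def supportDiff (z z' : Fin p → SignType) : Finset (Fin p) :=
  Finset.univ.filter fun j => ¬ (z j = 0 ↔ z' j = 0)

lemma mem_supportDiff {z z' : Fin p → SignType} {j : Fin p} :
    j ∈ supportDiff z z' ↔ ¬ (z j = 0 ↔ z' j = 0) := by
  simp [supportDiff]

lemma loss_eq (lam : ℝ) (X : Matrix (Fin n) (Fin p) ℝ) (β : Fin p → ℝ) (z z' : Fin p → SignType) :
    loss lam X β z z' = ∑ j, (((z j : SignType) : ℝ) - ((z' j : SignType) : ℝ)) ^ 2
      * (colNorm X j * max |β j| lam) ^ 2 := by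
  simp only [loss, localMean]
  exact Finset.sum_congr rfl fun j _ => by ring

lemma sq_sign_sub_le (a b : SignType) : ((a : ℝ) - (b : ℝ)) ^ 2 ≤ 4 := by
  rcases a with _ | _ | _ <;> rcases b with _ | _ | _ <;> norm_num

lemma sq_sign_sub_of_zero_iff_ne {a b : SignType} (h : ¬ (a = 0 ↔ b = 0)) :
    ((a : ℝ) - (b : ℝ)) ^ 2 = 1 := by
  rcases a with _ | _ | _ <;> rcases b with _ | _ | _ <;> simp_all

/-- The difference between the least-squares fits on two supports is controlled by the symmetric
difference of the supports. -/
lemma normSq_fit_sub_le {X : Matrix (Fin n) (Fin p) ℝ} {w : Fin n → ℝ} {α M : ℝ} {m : ℕ}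
    {z zstar : Fin p → SignType} {β b : Fin p → ℝ}
    (hRI : RestrictedIsometry X m α) (hn : 0 < n) (hα : α ≤ 1 / 2)
    (hβ : ∀ j, zstar j = 0 → β j = 0)
    (hD : (signSupport zstar ∪ supportDiff z zstar).card ≤ m)
    (hm : (signSupport zstar).card ≤ m) (hm1 : 1 ≤ m)
    (hW : ∀ j, |noiseDir X (signSupport zstar) j ⬝ᵥ w| ≤ M)
    (hb : IsLeastSquares X (response X β w) z b) :
    (∀ j, j ∉ signSupport zstar ∪ supportDiff z zstar →
        (β - oracleError X (signSupport zstar) w - b) j = 0) ∧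
      n * ((β - oracleError X (signSupport zstar) w - b) ⬝ᵥ
        (β - oracleError X (signSupport zstar) w - b))
        ≤ 32 * ∑ j ∈ supportDiff z zstar, (M ^ 2 + n * β j ^ 2) := by
  classical
  set S := signSupport zstar with hS
  set E := supportDiff z zstar with hE
  have hn' : (0 : ℝ) < n := by exact_mod_cast hn
  have hIS : IsNearIsometryOn X α S := hRI _ hm
  have hI : IsNearIsometryOn X α (S ∪ E) := hRI _ hD
  have hdet := hIS.det_maskedGram_ne_zero hn (by linarith)
  obtain ⟨h1, h2⟩ := oracleError_spec hdet w
  have hM : ∀ j, (noiseDir X S j ⬝ᵥ w) ^ 2 ≤ M ^ 2 := fun j =>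
    sq_le_sq.2 ((hW j).trans (le_abs_self M))
  have hcb := hRI.colNorm_sq_bounds hm1
  have hclo : ∀ j, n / 2 ≤ colNorm X j ^ 2 := fun j => le_trans (by nlinarith) (hcb j).1
  have hchi : ∀ j, colNorm X j ^ 2 ≤ 2 * n := fun j => (hcb j).2.trans (by nlinarith)
  have hc0 : ∀ j, colNorm X j ≠ 0 := fun j h0 => by
    have := hclo j; rw [h0] at this; norm_num at this; linarith
  set h := oracleError X S w with hh
  set d := β - h - b with hd
  have hstat : ∀ j, colNorm X j * (noiseDir X S j ⬝ᵥ w)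
      = colDot X j w + ∑ l ∈ Finset.univ.erase j, h l * gram X j l :=
    fun j => colNorm_mul_noiseDir hdet (hc0 j) w
  have hdoff : ∀ j, j ∉ S ∪ E → d j = 0 := by
    intro j hj
    simp only [Finset.mem_union, not_or] at hj
    have hz0 : zstar j = 0 := by simpa [hS, mem_signSupport] using hj.1
    have hz : z j = 0 := by
      have := hj.2
      rw [hE, mem_supportDiff, not_not] at this
      exact this.2 hz0
    simp [hd, hβ j hz0, h1 j hj.1, hb.eq_zero hz]
  refine ⟨hdoff, ?_⟩
  -- The normal equations of the current fit, written in terms of `d`. For `j ∈ S` the right side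
  -- vanishes by those of the oracle fit.
  have hnorm : ∀ j, z j ≠ 0 → ∑ l, d l * gram X j l
      = -(colDot X j w + ∑ l, h l * gram X j l) := by
    intro j hj
    have e := hb.normal_equation hj
    have e1 : response X β w - X *ᵥ b = X *ᵥ d + (w + X *ᵥ h) := by
      rw [response_eq, hd, mulVec_sub, mulVec_sub]; abel
    have e2 : colDot X j (X *ᵥ d + (w + X *ᵥ h))
        = colDot X j (X *ᵥ d) + (colDot X j w + colDot X j (X *ᵥ h)) := by
      simp [colDot, mul_add, Finset.sum_add_distrib]
    rw [e1, e2, colDot_mulVec, colDot_mulVec] at e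
    linarith
  set U := d ⬝ᵥ d with hU
  set V := X *ᵥ d ⬝ᵥ X *ᵥ d with hV
  have hU0 : 0 ≤ U := dotProduct_self_nonneg' d
  have hV0 : 0 ≤ V := dotProduct_self_nonneg' _
  have hUV : n * U ≤ 2 * V := by
    have := hI.le_normSq hdoff
    nlinarith [mul_nonneg hn'.le hU0]
  set d' : Fin p → ℝ := fun j => if j ∈ E ∩ S then d j else 0 with hd'
  set a : Fin p → ℝ := fun j =>
    if j ∈ E \ S then -(colNorm X j * (noiseDir X S j ⬝ᵥ w)) else 0 with ha
  -- In `‖X d‖² = ∑ dⱼ (Xᵀ X d)ⱼ` the correctly kept coordinates cancel. False discoveries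
  -- contribute oracle noise, collected in `a`; missed coordinates, where `b` is zero, are collected
  -- in `d'`.
  have hdec : V = d ⬝ᵥ a + X *ᵥ d' ⬝ᵥ X *ᵥ d := by
    rw [hV, mulVec_dotProduct_mulVec, mulVec_dotProduct_mulVec, dotProduct,
      ← Finset.sum_add_distrib]
    refine Finset.sum_congr rfl fun j _ => ?_
    by_cases hjS : j ∈ S
    · by_cases hjE : j ∈ E
      · simp [ha, hd', hjS, hjE]
      · have hz : z j ≠ 0 := by
          rw [hE, mem_supportDiff, not_not] at hjE
          exact fun h0 => (mem_signSupport.1 hjS) (hjE.1 h0)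
        rw [hnorm j hz, h2 j hjS]
        simp [ha, hd', hjE]
    · by_cases hjE : j ∈ E
      · have hz0 : zstar j = 0 := by simpa [hS, mem_signSupport] using hjS
        have hz : z j ≠ 0 := by
          rw [hE, mem_supportDiff] at hjE
          exact fun h0 => hjE (by simp [h0, hz0])
        rw [hnorm j hz]
        have e := hstat j
        rw [sum_erase_gram, h1 j hjS, zero_mul, sub_zero] at e
        rw [← e]
        simp [ha, hd', hjS, hjE]
      · rw [hdoff j (by simp [hjS, hjE])]
        simp [hd', hjS]
  have hA : (d ⬝ᵥ a) ^ 2 ≤ U * (2 * n * ∑ j ∈ E \ S, M ^ 2) := by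
    refine (sq_dotProduct_le _ _).trans (mul_le_mul_of_nonneg_left ?_ hU0)
    have e : a ⬝ᵥ a = ∑ j ∈ E \ S, (colNorm X j * (noiseDir X S j ⬝ᵥ w)) ^ 2 := by
      simp only [dotProduct, ha]
      rw [← Finset.sum_subset (Finset.subset_univ (E \ S))]
      · exact Finset.sum_congr rfl fun j hj => by rw [if_pos hj]; ring
      · intro j _ hj; simp only [if_neg hj, mul_zero]
    rw [e, Finset.mul_sum]
    refine Finset.sum_le_sum fun j _ => ?_
    rw [mul_pow]
    exact mul_le_mul (hchi j) (hM j) (sq_nonneg _) (by positivity)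
  have hd'off : ∀ j, j ∉ S ∪ E → d' j = 0 := fun j hj => by
    simp only [hd']; rw [if_neg]; simp at hj ⊢; tauto
  have hd'sq : n * (d' ⬝ᵥ d') ≤ ∑ j ∈ E ∩ S, (2 * n * β j ^ 2 + 4 * M ^ 2) := by
    have e : d' ⬝ᵥ d' = ∑ j ∈ E ∩ S, d j ^ 2 := by
      simp only [dotProduct, hd']
      rw [← Finset.sum_subset (Finset.subset_univ (E ∩ S))]
      · exact Finset.sum_congr rfl fun j hj => by rw [if_pos hj]; ring
      · intro j _ hj; simp only [if_neg hj, mul_zero]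
    rw [e, Finset.mul_sum]
    refine Finset.sum_le_sum fun j hj => ?_
    obtain ⟨hjE, hjS⟩ := Finset.mem_inter.1 hj
    have hz : z j = 0 := by
      rw [hE, mem_supportDiff] at hjE
      by_contra h0
      exact hjE (by simp [h0, mem_signSupport.1 hjS])
    have hdj : d j = β j - h j := by simp [hd, hb.eq_zero hz]
    have e1 := hstat j
    rw [sum_erase_gram, ← colNorm_sq] at e1
    have e2 := h2 j hjS
    -- On the support the oracle equation contains the diagonal term, so the oracle noise is the
    -- rescaled oracle error itself and `M` bounds both.
    have e3 : (noiseDir X S j ⬝ᵥ w) = -(h j * colNorm X j) :=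
      mul_left_cancel₀ (hc0 j) (by linarith)
    have e4 : h j ^ 2 * colNorm X j ^ 2 ≤ M ^ 2 := by
      have := hM j
      rw [e3] at this
      nlinarith
    have e5 : h j ^ 2 * (n / 2) ≤ M ^ 2 :=
      (mul_le_mul_of_nonneg_left (hclo j) (sq_nonneg _)).trans e4
    rw [hdj]
    nlinarith [mul_nonneg hn'.le (sq_nonneg (β j + h j))]
  have hB : (X *ᵥ d' ⬝ᵥ X *ᵥ d) ^ 2
      ≤ 2 * (∑ j ∈ E ∩ S, (2 * n * β j ^ 2 + 4 * M ^ 2)) * V := by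
    refine (sq_dotProduct_le _ _).trans (mul_le_mul_of_nonneg_right ?_ hV0)
    have := hI.normSq_le hd'off
    have h0 := mul_nonneg hn'.le (dotProduct_self_nonneg' d')
    nlinarith
  have hsplit : ∑ j ∈ E, (M ^ 2 + n * β j ^ 2)
      = ∑ j ∈ E \ S, (M ^ 2 + n * β j ^ 2) + ∑ j ∈ E ∩ S, (M ^ 2 + n * β j ^ 2) := by
    rw [add_comm, Finset.sum_inter_add_sum_sdiff]
  have hC1 : ∑ j ∈ E \ S, M ^ 2 ≤ ∑ j ∈ E \ S, (M ^ 2 + n * β j ^ 2) :=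
    Finset.sum_le_sum fun j _ => by have := sq_nonneg (β j); nlinarith
  have hC2 : ∑ j ∈ E ∩ S, (2 * n * β j ^ 2 + 4 * M ^ 2)
      ≤ 4 * ∑ j ∈ E ∩ S, (M ^ 2 + n * β j ^ 2) := by
    rw [Finset.mul_sum]
    exact Finset.sum_le_sum fun j _ => by
      have := mul_nonneg hn'.le (sq_nonneg (β j)); nlinarith
  set Q1 := ∑ j ∈ E \ S, (M ^ 2 + n * β j ^ 2) with hQ1
  set Q2 := ∑ j ∈ E ∩ S, (M ^ 2 + n * β j ^ 2) with hQ2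
  have hQ10 : 0 ≤ Q1 := Finset.sum_nonneg fun j _ => by positivity
  have hQ20 : 0 ≤ Q2 := Finset.sum_nonneg fun j _ => by positivity
  have hA' : (d ⬝ᵥ a) ^ 2 ≤ 4 * V * Q1 := by
    refine hA.trans ?_
    calc U * (2 * n * ∑ j ∈ E \ S, M ^ 2) ≤ U * (2 * n * Q1) := by gcongr
      _ = 2 * (n * U) * Q1 := by ring
      _ ≤ 2 * (2 * V) * Q1 := by gcongr
      _ = 4 * V * Q1 := by ring
  have hB' : (X *ᵥ d' ⬝ᵥ X *ᵥ d) ^ 2 ≤ 8 * Q2 * V := by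
    refine hB.trans ?_
    nlinarith [mul_le_mul_of_nonneg_right hC2 hV0]
  have hVfin : V ≤ 16 * (Q1 + Q2) := by
    rcases hV0.eq_or_lt with h0 | h0
    · rw [← h0]; positivity
    · refine le_of_mul_le_mul_left ?_ h0
      have : V * V = (d ⬝ᵥ a + X *ᵥ d' ⬝ᵥ X *ᵥ d) ^ 2 := by rw [← hdec]; ring
      rw [this]
      have := mul_nonneg hV0 hQ10
      nlinarith [sq_nonneg (d ⬝ᵥ a - X *ᵥ d' ⬝ᵥ X *ᵥ d)]
  rw [hsplit]
  linarith

/-- The deterministic level that the oracle noise has to exceed at a misclassified coordinate with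
coefficient `β` unless the fit is far from the oracle fit. -/
noncomputable def noiseThreshold (n p s : ℕ) (lam α δ β : ℝ) : ℝ :=
  if β = 0 then (1 - 2 * δ) * (1 - α)
      * (lam * √(n : ℝ) / 2 + Real.log (((p : ℝ) - (s : ℝ)) / (s : ℝ)) / (lam * √(n : ℝ)))
  else (1 - α) * √(n : ℝ) * ((1 - δ) * |β| - lam / 2)
      - (1 + α) * (Real.log (((p : ℝ) - (s : ℝ)) / (s : ℝ)) / (lam * √(n : ℝ)))

/-- A false discovery needs `|W + F| ≥ lam c / 2 + L / (lam c)`, with `L` the logarithm. The part `δ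
c lam` due to `F` is a fraction `2δ` of the first term, and replacing `c` by `√n` costs a factor `1
- α` in both terms. -/
lemma noiseThreshold_le_of_null {n p s : ℕ} {lam α δ c W F r : ℝ} (hn : 0 < n)
    (hlam : 0 < lam) (hδ0 : 0 ≤ δ) (hδ : δ ≤ 1 / 4) (hα0 : 0 ≤ α) (hα : α ≤ 1 / 2) (hc : 0 < c)
    (hL : 0 ≤ Real.log (((p : ℝ) - (s : ℝ)) / (s : ℝ)))
    (hc1 : n * (1 - α) ≤ c ^ 2) (hc2 : c ^ 2 ≤ n * (1 + α))
    (hF : |F| ≤ δ * (c * lam)) (hr : c * r = W + F)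
    (hex : lam / 2 + Real.log (((p : ℝ) - (s : ℝ)) / (s : ℝ)) / (lam * c ^ 2) ≤ |r|) :
    noiseThreshold n p s lam α δ 0 ≤ |W| := by
  set L := Real.log (((p : ℝ) - (s : ℝ)) / (s : ℝ)) with hLdef
  have hn' : (0 : ℝ) < n := by exact_mod_cast hn
  set g := √(n : ℝ) with hg
  have hg0 : 0 < g := Real.sqrt_pos.2 hn'
  have hg2 : g ^ 2 = n := Real.sq_sqrt hn'.le
  have hcl : (1 - α) * g ≤ c := by
    refine le_of_sq_le_sq ?_ hc.le
    rw [mul_pow, hg2]; nlinarith [mul_nonneg hn'.le hα0]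
  have hcu : c ≤ (1 + α) * g := by
    refine le_of_sq_le_sq ?_ (by positivity)
    rw [mul_pow, hg2]; nlinarith [mul_nonneg hn'.le hα0]
  have h1 : c * |r| ≤ |W| + |F| := by
    rw [← abs_of_pos hc, ← abs_mul, hr]; exact abs_add_le _ _
  have h2 : c * (lam / 2 + L / (lam * c ^ 2)) = lam * c / 2 + L / (lam * c) := by
    field_simp
  have h3 : lam * c / 2 + L / (lam * c) ≤ |W| + δ * (c * lam) := by
    rw [← h2]; exact (mul_le_mul_of_nonneg_left hex hc.le).trans (by linarith)
  have h4 : (1 - α) * (L / (lam * g)) ≤ L / (lam * c) := by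
    rw [← mul_div_assoc, div_le_div_iff₀ (by positivity) (by positivity)]
    have : (1 - α) * c ≤ g := by
      calc (1 - α) * c ≤ (1 - α) * ((1 + α) * g) := by gcongr; linarith
        _ ≤ g := by nlinarith [mul_nonneg hg0.le (sq_nonneg α)]
    nlinarith [mul_le_mul_of_nonneg_left this (mul_nonneg hL hlam.le)]
  have h5 : (1 - α) * (lam * g / 2 + L / (lam * g)) ≤ lam * c / 2 + L / (lam * c) := by
    nlinarith
  have h6 : 0 ≤ L / (lam * c) := by positivity
  unfold noiseThreshold
  rw [if_pos rfl, ← hLdef]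
  calc (1 - 2 * δ) * (1 - α) * (lam * g / 2 + L / (lam * g))
      = (1 - 2 * δ) * ((1 - α) * (lam * g / 2 + L / (lam * g))) := by ring
    _ ≤ (1 - 2 * δ) * (lam * c / 2 + L / (lam * c)) :=
        mul_le_mul_of_nonneg_left h5 (by linarith)
    _ ≤ |W| := by nlinarith [mul_nonneg hδ0 h6]

/-- The noise has to bridge the margin `|β| - t`, of which `F` supplies at most `δ |β|`. The
logarithmic term enters negatively here, so passing from `c` to `√n` enlarges it by `1 + α` while
the leading term shrinks by `1 - α`. -/
lemma noiseThreshold_le_of_signal {n p s : ℕ} {lam α δ c W F r β : ℝ} (hn : 0 < n)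
    (hlam : 0 < lam) (hδ : δ ≤ 1 / 4) (hα0 : 0 ≤ α) (hα : α ≤ 1 / 2) (hc : 0 < c)
    (hL : 0 ≤ Real.log (((p : ℝ) - (s : ℝ)) / (s : ℝ)))
    (hc1 : n * (1 - α) ≤ c ^ 2) (hβ : lam ≤ |β|)
    (hF : |F| ≤ δ * (c * |β|)) (hr : c * r = c * β + W + F)
    (hex : |β| - (lam / 2 + Real.log (((p : ℝ) - (s : ℝ)) / (s : ℝ)) / (lam * c ^ 2))
      ≤ |r - β|) :
    noiseThreshold n p s lam α δ β ≤ |W| := by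
  set L := Real.log (((p : ℝ) - (s : ℝ)) / (s : ℝ)) with hLdef
  have hn' : (0 : ℝ) < n := by exact_mod_cast hn
  set g := √(n : ℝ) with hg
  have hg0 : 0 < g := Real.sqrt_pos.2 hn'
  have hg2 : g ^ 2 = n := Real.sq_sqrt hn'.le
  have hcl : (1 - α) * g ≤ c := by
    refine le_of_sq_le_sq ?_ hc.le
    rw [mul_pow, hg2]; nlinarith [mul_nonneg hn'.le hα0]
  have h1 : c * |r - β| ≤ |W| + |F| := by
    rw [← abs_of_pos hc, ← abs_mul, mul_sub, hr]
    have : c * β + W + F - c * β = W + F := by ring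
    rw [this]; exact abs_add_le _ _
  have h2 : c * (lam / 2 + L / (lam * c ^ 2)) = lam * c / 2 + L / (lam * c) := by
    field_simp
  have h3 : c * |β| - (lam * c / 2 + L / (lam * c)) ≤ |W| + δ * (c * |β|) := by
    rw [← h2, ← mul_sub]; exact (mul_le_mul_of_nonneg_left hex hc.le).trans (by linarith)
  have h4 : L / (lam * c) ≤ (1 + α) * (L / (lam * g)) := by
    rw [← mul_div_assoc, div_le_div_iff₀ (by positivity) (by positivity)]
    have : g ≤ (1 + α) * c := by
      refine le_of_sq_le_sq ?_ (by positivity)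
      rw [mul_pow, hg2]
      have h0 : (1 : ℝ) ≤ (1 + α) ^ 2 * (1 - α) := by nlinarith [mul_nonneg hα0 hα0]
      nlinarith [mul_le_mul_of_nonneg_left hc1 (sq_nonneg (1 + α)),
        mul_le_mul_of_nonneg_left h0 hn'.le]
    nlinarith [mul_le_mul_of_nonneg_left this (mul_nonneg hL hlam.le)]
  have hβ0 : β ≠ 0 := by rintro rfl; simp at hβ; linarith
  have h5 : 0 ≤ (1 - δ) * |β| - lam / 2 := by nlinarith
  unfold noiseThreshold
  rw [if_neg hβ0, ← hLdef]
  have h6 := mul_le_mul_of_nonneg_right hcl h5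
  nlinarith

end Step

/-! ### Contraction of the loss in one step. -/

section Contraction

variable {n p : ℕ}

lemma eq_zero_of_mem_coeffSpace {z : Fin p → SignType} {lam : ℝ} {β : Fin p → ℝ}
    (hβ : β ∈ coeffSpace z lam) {j : Fin p} (hj : z j = 0) : β j = 0 := by
  have := hβ.1 j
  simpa [hj] using this

/-- The loss dominates the errors on the support, with margins that are linear in the loss. -/
lemma supportDiff_le_loss {X : Matrix (Fin n) (Fin p) ℝ} {α lam M : ℝ} {m : ℕ}
    {z zstar : Fin p → SignType} {β : Fin p → ℝ}
    (hRI : RestrictedIsometry X m α) (hα : α ≤ 1 / 2) (hm1 : 1 ≤ m) (hlam : 0 < lam) :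
    (supportDiff z zstar).card * (n * lam ^ 2 / 2) ≤ loss lam X β z zstar ∧
      (1 ≤ n * lam ^ 2 → 1 ≤ M ^ 2 → ∑ j ∈ supportDiff z zstar, (M ^ 2 + n * β j ^ 2)
        ≤ 4 * M ^ 2 * loss lam X β z zstar) := by
  have hn0 : (0 : ℝ) ≤ n := Nat.cast_nonneg n
  have hclo : ∀ j, n / 2 ≤ colNorm X j ^ 2 := fun j =>
    le_trans (by nlinarith) (hRI.colNorm_sq_bounds hm1 j).1
  have hmax : ∀ j, lam ^ 2 ≤ max |β j| lam ^ 2 ∧ β j ^ 2 ≤ max |β j| lam ^ 2 := fun j =>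
    ⟨pow_le_pow_left₀ hlam.le (le_max_right _ _) 2,
      by rw [← sq_abs (β j)]; exact pow_le_pow_left₀ (abs_nonneg _) (le_max_left _ _) 2⟩
  have hterm : ∀ j, n / 2 * max |β j| lam ^ 2 ≤ (colNorm X j * max |β j| lam) ^ 2 := fun j => by
    rw [mul_pow]; exact mul_le_mul_of_nonneg_right (hclo j) (sq_nonneg _)
  have hsub : ∑ j ∈ supportDiff z zstar, (colNorm X j * max |β j| lam) ^ 2
      ≤ loss lam X β z zstar := by
    rw [loss_eq]
    refine le_trans (Finset.sum_le_sum fun j hj => ?_)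
      (Finset.sum_le_sum_of_subset_of_nonneg (Finset.subset_univ _) fun j _ _ => by positivity)
    rw [sq_sign_sub_of_zero_iff_ne (mem_supportDiff.1 hj), one_mul]
  constructor
  · refine le_trans ?_ hsub
    rw [← nsmul_eq_mul]
    refine Finset.card_nsmul_le_sum _ _ _ fun j _ => le_trans ?_ (hterm j)
    nlinarith [(hmax j).1]
  · intro h1 hM
    refine le_trans ?_ (mul_le_mul_of_nonneg_left hsub (by positivity))
    rw [Finset.mul_sum]
    refine Finset.sum_le_sum fun j _ => ?_
    have e1 := hterm j
    have e2 := mul_le_mul_of_nonneg_left (hmax j).1 hn0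
    have e3 := mul_le_mul_of_nonneg_left (hmax j).2 hn0
    have e4 := mul_le_mul_of_nonneg_left (h1.trans e2) (sq_nonneg M)
    have e5 : (n : ℝ) * β j ^ 2 ≤ M ^ 2 * (n * max |β j| lam ^ 2) :=
      e3.trans (le_mul_of_one_le_left (by positivity) hM)
    have e6 := mul_le_mul_of_nonneg_left e1 (sq_nonneg M)
    nlinarith

open Classical in
/-- The loss caused by the oracle noise at coordinates where it exceeds its threshold. -/
noncomputable def oracleLoss (s : ℕ) (lam α δ : ℝ) (β : Fin p → ℝ) (S : Finset (Fin p))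
    (X : Matrix (Fin n) (Fin p) ℝ) (w : Fin n → ℝ) : ℝ :=
  ∑ j, 8 * n * max |β j| lam ^ 2 *
    if noiseThreshold n p s lam α δ (β j) ≤ |noiseDir X S j ⬝ᵥ w| then 1 else 0

/-- A misclassified coordinate has large oracle noise or a large deviation from the oracle. -/
lemma noiseThreshold_le_of_thresholdStep_ne {s : ℕ} {lam α δ : ℝ} {X : Matrix (Fin n) (Fin p) ℝ}
    {Y : Fin n → ℝ} {zstar : Fin p → SignType} {β b : Fin p → ℝ} {j : Fin p} {W F : ℝ}
    (hn : 0 < n) (hlam : 0 < lam) (hδ0 : 0 ≤ δ) (hδ : δ ≤ 1 / 4) (hα0 : 0 ≤ α) (hα : α ≤ 1 / 2)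
    (hL : 0 ≤ Real.log (((p : ℝ) - (s : ℝ)) / (s : ℝ)))
    (hc : 0 < colNorm X j) (hc1 : n * (1 - α) ≤ colNorm X j ^ 2)
    (hc2 : colNorm X j ^ 2 ≤ n * (1 + α)) (hβ : β ∈ coeffSpace zstar lam)
    (hr : colNorm X j * residualStat X Y b j = colNorm X j * β j + W + F)
    (hF : |F| ≤ δ * (colNorm X j * max |β j| lam))
    (hne : thresholdStep s lam X Y b j ≠ zstar j) :
    noiseThreshold n p s lam α δ (β j) ≤ |W| := by
  -- A nonnegative threshold puts an estimate of the wrong sign on the wrong side of the detection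
  -- threshold, just like a missed one, so both errors are treated together.
  have ht : 0 ≤ threshold s lam X j := by unfold threshold; positivity
  by_cases hz : zstar j = 0
  · have hβj := eq_zero_of_mem_coeffSpace hβ hz
    rw [hβj] at hr hF ⊢
    rw [abs_zero, max_eq_right hlam.le] at hF
    refine noiseThreshold_le_of_null hn hlam hδ0 hδ hα0 hα hc hL hc1 hc2 hF
      (r := residualStat X Y b j) (by linarith) ?_
    change threshold s lam X j ≤ _
    rw [hz] at hne
    unfold thresholdStep at hne
    split_ifs at hne with h1 h2
    · exact h1.le.trans (le_abs_self _)
    · exact le_trans (by linarith) (neg_le_abs _)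
    · exact absurd rfl hne
  · have hlamβ := hβ.2 j hz
    rw [max_eq_left hlamβ] at hF
    refine noiseThreshold_le_of_signal hn hlam hδ hα0 hα hc hL hc1 hlamβ hF
      (r := residualStat X Y b j) hr ?_
    change |β j| - threshold s lam X j ≤ _
    have hsign := hβ.1 j
    unfold thresholdStep at hne
    rcases hs : zstar j with _ | _ | _
    · exact absurd hs hz
    · rw [hs] at hne hsign
      have hb : β j = -|β j| := by simpa using hsign
      have : -threshold s lam X j ≤ residualStat X Y b j := by
        split_ifs at hne with h1 h2
        · linarith
        · exact absurd rfl hne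
        · linarith
      refine le_trans ?_ (le_abs_self _)
      linarith
    · rw [hs] at hne hsign
      have hb : β j = |β j| := by simpa using hsign
      have : residualStat X Y b j ≤ threshold s lam X j := by
        split_ifs at hne with h1 h2
        · exact absurd rfl hne
        · linarith
        · linarith
      refine le_trans ?_ (neg_le_abs _)
      linarith

/-- Splitting `β - b` into the oracle error and the deviation from the oracle fit separates a noise
term that does not depend on `b` from a term linear in the deviation. -/
lemma colNorm_mul_residualStat {X : Matrix (Fin n) (Fin p) ℝ} {β b : Fin p → ℝ} {w : Fin n → ℝ}
    {S : Finset (Fin p)} (hdet : (maskedGram X S).det ≠ 0) {j : Fin p} (hc : colNorm X j ≠ 0) :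
    colNorm X j * residualStat X (response X β w) b j = colNorm X j * β j + noiseDir X S j ⬝ᵥ w
      + (colNorm X j)⁻¹ * ∑ l ∈ Finset.univ.erase j,
          (β - oracleError X S w - b) l * gram X j l := by
  have h1 := colNorm_mul_noiseDir hdet hc w
  have h2 : noiseDir X S j ⬝ᵥ w = (colNorm X j)⁻¹ * (colDot X j w
      + ∑ l ∈ Finset.univ.erase j, oracleError X S w l * gram X j l) := by
    rw [← h1, inv_mul_cancel_left₀ hc]
  have h3 : colDot X j (response X β w)
      = β j * colNorm X j ^ 2 + ∑ l ∈ Finset.univ.erase j, β l * gram X j l + colDot X j w := by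
    have : colDot X j (response X β w) = colDot X j (X *ᵥ β) + colDot X j w := by
      simp [response_eq, colDot, mul_add, Finset.sum_add_distrib]
    rw [this, colDot_mulVec, sum_erase_gram, colNorm_sq]; ring
  have h4 : ∑ l ∈ Finset.univ.erase j, (β - oracleError X S w - b) l * gram X j l
      = ∑ l ∈ Finset.univ.erase j, β l * gram X j l
        - ∑ l ∈ Finset.univ.erase j, oracleError X S w l * gram X j l
        - ∑ l ∈ Finset.univ.erase j, b l * gram X j l := by
    simp only [Pi.sub_apply, sub_mul, Finset.sum_sub_distrib]
  rw [h2, h4, residualStat, h3]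
  field_simp
  ring

set_option maxHeartbeats 1000000 in
/-- One step of the algorithm contracts the loss up to the oracle loss. -/
lemma loss_thresholdStep_le {s B m : ℕ} {lam α δ M : ℝ} {X : Matrix (Fin n) (Fin p) ℝ}
    {w : Fin n → ℝ} {z zstar : Fin p → SignType} {β b : Fin p → ℝ}
    (hn : 0 < n) (hlam : 0 < lam) (hδ0 : 0 < δ) (hδ : δ ≤ 1 / 4) (hα0 : 0 ≤ α) (hα : α ≤ 1 / 2)
    (hL : 0 ≤ Real.log (((p : ℝ) - (s : ℝ)) / (s : ℝ)))
    (hs : 1 ≤ s) (hB : 1 ≤ B) (hm : (2 * B + 2) * s ≤ m)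
    (hRI : RestrictedIsometry X m α) (hz : zstar ∈ signPatterns p s)
    (hβ : β ∈ coeffSpace zstar lam)
    (hnl : 1 ≤ n * lam ^ 2) (hM1 : 1 ≤ M ^ 2)
    (hW : ∀ j, |noiseDir X (signSupport zstar) j ⬝ᵥ w| ≤ M)
    (hsmall : 8192 * B * α ^ 2 * M ^ 2 ≤ δ ^ 2)
    (hloss : loss lam X β z zstar ≤ B * s * n * lam ^ 2)
    (hb : IsLeastSquares X (response X β w) z b) :
    loss lam X β (thresholdStep s lam X (response X β w) b) zstar
      ≤ oracleLoss s lam α δ β (signSupport zstar) X w + 1 / 2 * loss lam X β z zstar := by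
  classical
  have hn' : (0 : ℝ) < n := by exact_mod_cast hn
  have hs' : (1 : ℝ) ≤ s := by exact_mod_cast hs
  have hB' : (1 : ℝ) ≤ B := by exact_mod_cast hB
  have hcard := card_signSupport hz
  have hm1 : 1 ≤ m := by nlinarith
  set S := signSupport zstar with hS
  set E := supportDiff z zstar with hE
  set ℓ := loss lam X β z zstar with hℓ
  have hℓ0 : 0 ≤ ℓ := Finset.sum_nonneg fun j _ => sq_nonneg _
  obtain ⟨hE1, hE2⟩ := supportDiff_le_loss (M := M) (z := z) (zstar := zstar) (β := β)
    hRI hα hm1 hlam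
  have hE3 := hE2 hnl hM1
  have hEcard : E.card ≤ 2 * B * s := by
    have h1 : (E.card : ℝ) * (n * lam ^ 2 / 2) ≤ (2 * B * s : ℝ) * (n * lam ^ 2 / 2) := by
      refine hE1.trans (hloss.trans (le_of_eq ?_)); ring
    have h2 := le_of_mul_le_mul_right h1 (by positivity)
    exact_mod_cast h2
  have hD : (S ∪ E).card ≤ (2 * B + 1) * s := by
    refine (Finset.card_union_le _ _).trans ?_
    rw [hcard]; nlinarith
  have hIS : IsNearIsometryOn X α S := hRI _ (by rw [hcard]; nlinarith)
  have hdet := hIS.det_maskedGram_ne_zero hn (by linarith)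
  have hcb := hRI.colNorm_sq_bounds hm1
  have hclo : ∀ j, n / 2 ≤ colNorm X j ^ 2 := fun j => le_trans (by nlinarith) (hcb j).1
  have hchi : ∀ j, colNorm X j ^ 2 ≤ 2 * n := fun j => (hcb j).2.trans (by nlinarith)
  have hc0 : ∀ j, 0 < colNorm X j := fun j => by
    have h0 : 0 ≤ colNorm X j := Real.sqrt_nonneg _
    have := hclo j
    refine lt_of_le_of_ne h0 fun h => ?_
    rw [← h] at this; norm_num at this; linarith
  obtain ⟨hdoff, hdU⟩ := normSq_fit_sub_le hRI hn hα
    (fun j hj => eq_zero_of_mem_coeffSpace hβ hj) (hD.trans (by nlinarith))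
    (by rw [← hS, hcard]; nlinarith) hm1 hW hb
  set d := β - oracleError X S w - b with hd
  have hU : n * (d ⬝ᵥ d) ≤ 128 * M ^ 2 * ℓ := by
    refine hdU.trans ?_
    linarith
  set F : Fin p → ℝ := fun j =>
    (colNorm X j)⁻¹ * ∑ l ∈ Finset.univ.erase j, d l * gram X j l with hF
  -- The isometry is used on `T ∪ S ∪ E`, with at most `s + s + 2 B s` elements; this explains the
  -- order `(2 * B + 2) * s`.
  have hFsum : ∀ T : Finset (Fin p), T.card ≤ s →
      ∑ j ∈ T, F j ^ 2 ≤ 1024 * α ^ 2 * M ^ 2 * ℓ := by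
    intro T hT
    have hI : IsNearIsometryOn X α (T ∪ (S ∪ E)) :=
      hRI _ ((Finset.card_union_le _ _).trans (by nlinarith))
    have h1 := hI.sum_sq_offDiag_le (T := T) Finset.subset_union_left (d := d)
      (fun j hj => hdoff j fun h => hj (Finset.mem_union_right _ h))
    have h2 : n / 2 * ∑ j ∈ T, F j ^ 2 ≤ 4 * (n * α) ^ 2 * (d ⬝ᵥ d) := by
      refine le_trans ?_ h1
      rw [Finset.mul_sum]
      refine Finset.sum_le_sum fun j _ => ?_
      rw [hF]
      simp only
      rw [mul_pow, ← mul_assoc]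
      refine mul_le_of_le_one_left (sq_nonneg _) ?_
      rw [inv_pow, ← div_eq_mul_inv, div_le_one (pow_pos (hc0 j) 2)]
      exact hclo j
    have h3 : 4 * (n * α) ^ 2 * (d ⬝ᵥ d) ≤ n / 2 * (1024 * α ^ 2 * M ^ 2 * ℓ) := by
      have := mul_le_mul_of_nonneg_left hU (show 0 ≤ 4 * n * α ^ 2 by positivity)
      nlinarith
    exact le_of_mul_le_mul_left (h2.trans h3) (by positivity)
  set x : Fin p → ℝ := fun j => colNorm X j * max |β j| lam with hx
  have hx0 : ∀ j, 0 ≤ x j := fun j => mul_nonneg (hc0 j).le (le_max_of_le_right hlam.le)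
  have hxlo : ∀ j, n * lam ^ 2 / 2 ≤ x j ^ 2 := fun j => by
    have : lam ^ 2 ≤ max |β j| lam ^ 2 := pow_le_pow_left₀ hlam.le (le_max_right _ _) 2
    rw [hx]; simp only; rw [mul_pow]
    calc n * lam ^ 2 / 2 = n / 2 * lam ^ 2 := by ring
      _ ≤ colNorm X j ^ 2 * max |β j| lam ^ 2 :=
        mul_le_mul (hclo j) this (sq_nonneg _) (sq_nonneg _)
  set T := Finset.univ.filter fun j => δ * x j < |F j| with hT
  have hTsq : ∀ j ∈ T, δ ^ 2 * x j ^ 2 ≤ F j ^ 2 := fun j hj => by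
    have := (Finset.mem_filter.1 hj).2
    rw [← sq_abs (F j), ← mul_pow]
    exact pow_le_pow_left₀ (mul_nonneg hδ0.le (hx0 j)) this.le 2
  -- The size of `T` is not known in advance, so `hFsum` is applied to a subset of exactly `s`
  -- elements. There the lower bound `δ² s n lam² / 2` exceeds the upper bound `δ² s n lam² / 8`.
  have hTcard : T.card ≤ s := by
    by_contra hcon
    push Not at hcon
    obtain ⟨T', hT'T, hT'⟩ := Finset.exists_subset_card_eq hcon.le
    have h1 := hFsum T' hT'.le
    have h2 : (s : ℝ) * (δ ^ 2 * (n * lam ^ 2 / 2)) ≤ ∑ j ∈ T', F j ^ 2 := by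
      rw [← hT', ← nsmul_eq_mul]
      refine Finset.card_nsmul_le_sum _ _ _ fun j hj => le_trans ?_ (hTsq j (hT'T hj))
      exact mul_le_mul_of_nonneg_left (hxlo j) (sq_nonneg _)
    have h3 : 1024 * α ^ 2 * M ^ 2 * ℓ ≤ 1024 * α ^ 2 * M ^ 2 * (B * s * n * lam ^ 2) := by
      gcongr
    have h4 : 1024 * α ^ 2 * M ^ 2 * (B * s * n * lam ^ 2)
        = 8192 * B * α ^ 2 * M ^ 2 * (s * n * lam ^ 2 / 8) := by ring
    have h5 : 8192 * B * α ^ 2 * M ^ 2 * (s * n * lam ^ 2 / 8)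
        ≤ δ ^ 2 * (s * n * lam ^ 2 / 8) := by gcongr
    have h6 : 0 < δ ^ 2 * (s * n * lam ^ 2) := by positivity
    nlinarith
  -- The 4 bounds the squared difference of two signs, and `8192 = 2 * 4 * 1024` yields the factor
  -- `1 / 2`.
  have hTsum : ∑ j ∈ T, 4 * x j ^ 2 ≤ 1 / 2 * ℓ := by
    have h1 : δ ^ 2 * ∑ j ∈ T, 4 * x j ^ 2 ≤ 4 * ∑ j ∈ T, F j ^ 2 := by
      rw [Finset.mul_sum, Finset.mul_sum]
      exact Finset.sum_le_sum fun j hj => by linarith [hTsq j hj]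
    have h2 : δ ^ 2 * ∑ j ∈ T, 4 * x j ^ 2 ≤ δ ^ 2 * (1 / 2 * ℓ) := by
      refine h1.trans ?_
      have h3 := hFsum T hTcard
      have h4 : 8192 * α ^ 2 * M ^ 2 ≤ δ ^ 2 := by
        refine le_trans ?_ hsmall
        have : 0 ≤ α ^ 2 * M ^ 2 := by positivity
        nlinarith
      nlinarith [mul_le_mul_of_nonneg_right h4 hℓ0]
    exact le_of_mul_le_mul_left h2 (by positivity)
  have hT0 : ∑ j ∈ T, 4 * x j ^ 2 = ∑ j, if j ∈ T then 4 * x j ^ 2 else 0 := by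
    rw [Finset.sum_ite_mem, Finset.univ_inter]
  refine le_trans ?_ (add_le_add_right hTsum _)
  rw [loss_eq, oracleLoss, hT0, ← Finset.sum_add_distrib]
  refine Finset.sum_le_sum fun j _ => ?_
  change _ * x j ^ 2 ≤ _
  have hxhi : 4 * x j ^ 2 ≤ 8 * n * max |β j| lam ^ 2 := by
    rw [hx]; simp only; rw [mul_pow]
    nlinarith [mul_le_mul_of_nonneg_right (hchi j) (sq_nonneg (max |β j| lam))]
  have hite : 0 ≤ 8 * n * max |β j| lam ^ 2 *
      if noiseThreshold n p s lam α δ (β j) ≤ |noiseDir X S j ⬝ᵥ w| then (1 : ℝ) else 0 := by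
    split_ifs <;> positivity
  have hsq := mul_le_mul_of_nonneg_right
    (sq_sign_sub_le (thresholdStep s lam X (response X β w) b j) (zstar j)) (sq_nonneg (x j))
  by_cases hne : thresholdStep s lam X (response X β w) b j = zstar j
  · rw [hne, sub_self]
    have : (0 : ℝ) ≤ if j ∈ T then 4 * x j ^ 2 else 0 := by split_ifs <;> positivity
    linarith
  · by_cases hjT : j ∈ T
    · rw [if_pos hjT]; linarith
    · have hFj : |F j| ≤ δ * x j := by
        by_contra h
        exact hjT (Finset.mem_filter.2 ⟨Finset.mem_univ _, not_le.1 h⟩)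
      have := noiseThreshold_le_of_thresholdStep_ne (α := α) hn hlam hδ0.le hδ hα0 hα hL (hc0 j)
        (hcb j).1 (hcb j).2 hβ (colNorm_mul_residualStat hdet (hc0 j).ne') hFj hne
      rw [if_pos this, if_neg hjT]
      linarith

end Contraction

/-! ### From a finite net to the restricted isometry property. -/

section Net

variable {n p : ℕ}

open Classical in
/-- The vectors with at most `m` nonzero entries, all of them of the form `a / N` with `a` an
integer of modulus at most `N`. -/
noncomputable def gridNet (p N : ℕ) : ℕ → Finset (Fin p → ℝ)
  | 0 => {0}
  | m + 1 => gridNet p N m ∪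
      ((gridNet p N m ×ˢ (Finset.univ : Finset (Fin p))) ×ˢ Finset.Icc (-(N : ℤ)) N).image
        fun e => Function.update e.1.1 e.1.2 ((e.2 : ℝ) / N)

lemma card_gridNet_le (p N m : ℕ) : (gridNet p N m).card ≤ (p * (2 * N + 1) + 1) ^ m := by
  induction m with
  | zero => simp [gridNet]
  | succ m ih =>
    rw [gridNet]
    refine (Finset.card_union_le _ _).trans ?_
    refine (add_le_add_right Finset.card_image_le _).trans ?_
    rw [Finset.card_product, Finset.card_product, Finset.card_univ, Fintype.card_fin,
      Int.card_Icc]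
    have : ((N : ℤ) + 1 - -(N : ℤ)).toNat = 2 * N + 1 := by omega
    rw [this]
    calc _ = (gridNet p N m).card * (p * (2 * N + 1) + 1) := by ring
      _ ≤ (p * (2 * N + 1) + 1) ^ m * (p * (2 * N + 1) + 1) := by gcongr
      _ = _ := (pow_succ _ _).symm

lemma gridNet_mono (p N : ℕ) : Monotone (gridNet p N) :=
  monotone_nat_of_le_succ fun m => by rw [gridNet]; exact Finset.subset_union_left

lemma mem_gridNet {N : ℕ} (D : Finset (Fin p)) (a : Fin p → ℤ) (ha : ∀ j, |a j| ≤ N)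
    (hD : ∀ j, j ∉ D → a j = 0) : (fun j => (a j : ℝ) / N) ∈ gridNet p N D.card := by
  classical
  induction D using Finset.induction_on generalizing a with
  | empty =>
    have : (fun j => (a j : ℝ) / N) = 0 := by
      funext j; simp [hD j (Finset.notMem_empty j)]
    rw [this]; simp [gridNet]
  | insert i D hi ih =>
    rw [Finset.card_insert_of_notMem hi, gridNet]
    refine Finset.mem_union_right _ (Finset.mem_image.2
      ⟨((fun j => ((Function.update a i 0 j : ℤ) : ℝ) / N, i), a i), ?_, ?_⟩)
    · simp only [Finset.mem_product, Finset.mem_univ, and_true, Finset.mem_Icc]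
      refine ⟨ih (Function.update a i 0) (fun j => ?_) (fun j hj => ?_), abs_le.1 (ha i)⟩
      · by_cases h : j = i
        · subst h; simp
        · simpa [h] using ha j
      · by_cases h : j = i
        · subst h; simp
        · simp only [Function.update_of_ne h]
          exact hD j (by simp [h, hj])
    · funext j
      by_cases h : j = i
      · subst h; simp
      · simp [h]

/-- Rounding down to multiples of `1 / (8 m)` changes at most `m` coordinates, so the squared error
is at most `1 / (64 m)`. -/
lemma exists_mem_gridNet_near {m : ℕ} (hm : 1 ≤ m) {D : Finset (Fin p)} (hD : D.card ≤ m)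
    {u : Fin p → ℝ} (hu : ∀ j, j ∉ D → u j = 0) (hu1 : u ⬝ᵥ u ≤ 1) :
    ∃ v ∈ gridNet p (8 * m) m, (∀ j, j ∉ D → v j = 0) ∧ (u - v) ⬝ᵥ (u - v) ≤ 1 / 64 := by
  have hm' : (1 : ℝ) ≤ m := by exact_mod_cast hm
  have huj : ∀ j, |u j| ≤ 1 := fun j => by
    refine abs_le_of_sq_le_sq ?_ zero_le_one
    have : u j * u j ≤ u ⬝ᵥ u :=
      Finset.single_le_sum (f := fun j => u j * u j) (fun i _ => mul_self_nonneg _)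
        (Finset.mem_univ j)
    nlinarith
  set N : ℕ := 8 * m with hN
  have hN0 : (0 : ℝ) < N := by rw [hN]; push_cast; linarith
  set a : Fin p → ℤ := fun j => ⌊(N : ℝ) * u j⌋ with ha
  have haD : ∀ j, j ∉ D → a j = 0 := fun j hj => by simp [ha, hu j hj]
  refine ⟨fun j => (a j : ℝ) / N, gridNet_mono p N hD (mem_gridNet D a (fun j => ?_) haD),
    fun j hj => by simp [haD j hj], ?_⟩
  · have h := abs_le.1 (huj j)
    rw [abs_le]
    constructor
    · rw [ha]; simp only; rw [Int.le_floor]; push_cast; nlinarith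
    · have : ((a j : ℤ) : ℝ) ≤ (N : ℤ) := (Int.floor_le _).trans (by push_cast; nlinarith)
      exact_mod_cast this
  · have hterm : ∀ j, (u j - (a j : ℝ) / N) ^ 2 ≤ if j ∈ D then 1 / (N : ℝ) ^ 2 else 0 := by
      intro j
      split_ifs with hj
      · have h1 := Int.floor_le ((N : ℝ) * u j)
        have h2 := Int.lt_floor_add_one ((N : ℝ) * u j)
        have e : u j - (a j : ℝ) / N = ((N : ℝ) * u j - a j) / N := by field_simp
        rw [e, div_pow]
        gcongr
        have h3 : 0 ≤ (N : ℝ) * u j - a j := by simp only [ha]; linarith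
        have h4 : (N : ℝ) * u j - a j ≤ 1 := by simp only [ha]; linarith
        exact pow_le_one₀ h3 h4
      · simp [hu j hj, haD j hj]
    calc (u - fun j => (a j : ℝ) / N) ⬝ᵥ (u - fun j => (a j : ℝ) / N)
        = ∑ j, (u j - (a j : ℝ) / N) ^ 2 := by simp [dotProduct, sq]
      _ ≤ ∑ j, if j ∈ D then 1 / (N : ℝ) ^ 2 else 0 := Finset.sum_le_sum fun j _ => hterm j
      _ = D.card * (1 / (N : ℝ) ^ 2) := by
        rw [Finset.sum_ite_mem, Finset.univ_inter, Finset.sum_const, nsmul_eq_mul]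
      _ ≤ m * (1 / (N : ℝ) ^ 2) := by gcongr
      _ ≤ 1 / 64 := by
        rw [hN]; push_cast
        rw [mul_one_div, div_le_iff₀ (by positivity)]
        nlinarith

/-- A crude constant from the Frobenius norm. It only serves to make the infimum of admissible
constants in `RestrictedIsometry.of_gridNet` one over a nonempty set. -/
lemma exists_isNearIsometryOn (X : Matrix (Fin n) (Fin p) ℝ) (hn : 0 < n) (D : Finset (Fin p)) :
    ∃ a, 0 ≤ a ∧ IsNearIsometryOn X a D := by
  have hn' : (0 : ℝ) < n := by exact_mod_cast hn
  set C := ∑ i, ∑ j, X i j ^ 2 with hC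
  have hC0 : 0 ≤ C := Finset.sum_nonneg fun i _ => Finset.sum_nonneg fun j _ => sq_nonneg _
  refine ⟨C / n + 1, by positivity, fun u _ => ?_⟩
  have h1 : X *ᵥ u ⬝ᵥ X *ᵥ u ≤ C * (u ⬝ᵥ u) := by
    rw [hC, Finset.sum_mul]
    refine Finset.sum_le_sum fun i _ => ?_
    have := sq_dotProduct_le (X i) u
    have e : X i ⬝ᵥ X i = ∑ j, X i j ^ 2 := by simp [dotProduct, sq]
    rw [e] at this
    rw [← sq]
    exact this
  have h2 := dotProduct_self_nonneg' u
  have h3 := dotProduct_self_nonneg' (X *ᵥ u)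
  have e : n * (C / n + 1) * (u ⬝ᵥ u) = C * (u ⬝ᵥ u) + n * (u ⬝ᵥ u) := by field_simp
  rw [e, abs_le]
  have h4 := mul_nonneg hn'.le h2
  have h5 := mul_nonneg hC0 h2
  constructor <;> linarith

lemma IsNearIsometryOn.mono {X : Matrix (Fin n) (Fin p) ℝ} {a b : ℝ} {D : Finset (Fin p)}
    (h : IsNearIsometryOn X a D) (hab : a ≤ b) : IsNearIsometryOn X b D := fun u hu =>
  (h u hu).trans (by have := dotProduct_self_nonneg' u; gcongr)

lemma IsNearIsometryOn.of_unit {X : Matrix (Fin n) (Fin p) ℝ} {a : ℝ} {D : Finset (Fin p)}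
    (h : ∀ u : Fin p → ℝ, (∀ j, j ∉ D → u j = 0) → u ⬝ᵥ u = 1 →
      |X *ᵥ u ⬝ᵥ X *ᵥ u - n| ≤ n * a) : IsNearIsometryOn X a D := by
  intro u hu
  rcases (dotProduct_self_nonneg' u).eq_or_lt with h0 | h0
  · rw [dotProduct_self_eq_zero.1 h0.symm]; simp
  · set r := √(u ⬝ᵥ u) with hr
    have hr0 : 0 < r := Real.sqrt_pos.2 h0
    have hr2 : r ^ 2 = u ⬝ᵥ u := Real.sq_sqrt h0.le
    have h1 := h (r⁻¹ • u) (fun j hj => by simp [hu j hj]) (by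
      simp only [smul_dotProduct, dotProduct_smul, smul_eq_mul]
      rw [← hr2]; field_simp)
    simp only [mulVec_smul, smul_dotProduct, dotProduct_smul, smul_eq_mul] at h1
    have e : X *ᵥ u ⬝ᵥ X *ᵥ u - n * (u ⬝ᵥ u)
        = (r⁻¹ * (r⁻¹ * (X *ᵥ u ⬝ᵥ X *ᵥ u)) - n) * r ^ 2 := by
      rw [← hr2]; field_simp
    rw [e, abs_mul, ← hr2, abs_of_nonneg (sq_nonneg r)]
    gcongr

/-- The restricted isometry property follows from its instances at the vectors of a finite net. -/
lemma RestrictedIsometry.of_gridNet {X : Matrix (Fin n) (Fin p) ℝ} {m : ℕ} {τ : ℝ} (hn : 0 < n)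
    (hm : 1 ≤ m) (hτ : 0 < τ)
    (h : ∀ v ∈ gridNet p (8 * m) m, |X *ᵥ v ⬝ᵥ X *ᵥ v - n * (v ⬝ᵥ v)| ≤ n * τ * (v ⬝ᵥ v)) :
    RestrictedIsometry X m (2 * τ) := by
  intro D hD
  have hn' : (0 : ℝ) < n := by exact_mod_cast hn
  -- Self-improvement of the constant: with `Q(u) = ‖X u‖² - n ‖u‖²` and its bilinear form, `Q(u) =
  -- Q(v) + Q(u - v, u + v)`. Here `‖v‖ ≤ 9 / 8`, `‖u - v‖ ≤ 1 / 8` and `‖u + v‖ ≤ 17 / 8`, which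
  -- gives `81 / 64` and `17 / 64`.
  have step : ∀ a, 0 ≤ a → IsNearIsometryOn X a D →
      IsNearIsometryOn X (81 / 64 * τ + 17 / 64 * a) D := by
    intro a ha0 ha
    refine IsNearIsometryOn.of_unit fun u hu hu1 => ?_
    obtain ⟨v, hv, hvD, hvu⟩ := exists_mem_gridNet_near hm hD hu hu1.le
    set e := u - v with he
    have heD : ∀ j, j ∉ D → e j = 0 := fun j hj => by simp [he, hu j hj, hvD j hj]
    have hgD : ∀ j, j ∉ D → (u + v) j = 0 := fun j hj => by simp [hu j hj, hvD j hj]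
    have hv_eq : v = u - e := by rw [he]; abel
    have hue : |u ⬝ᵥ e| ≤ 1 / 8 := by
      refine abs_le_of_sq_le_sq ((sq_dotProduct_le u e).trans ?_) (by norm_num)
      rw [hu1]; linarith
    have hue' := abs_le.1 hue
    have hvv : v ⬝ᵥ v ≤ 81 / 64 := by
      rw [hv_eq]
      simp only [sub_dotProduct, dotProduct_sub, dotProduct_comm e u, hu1]
      linarith
    have hgg : (u + v) ⬝ᵥ (u + v) ≤ 289 / 64 := by
      rw [hv_eq]
      simp only [add_dotProduct, dotProduct_add, sub_dotProduct, dotProduct_sub,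
        dotProduct_comm e u, hu1]
      linarith
    have hB := ha.sq_bilin_le heD hgD
    have hB' : |X *ᵥ e ⬝ᵥ X *ᵥ (u + v) - n * (e ⬝ᵥ (u + v))| ≤ n * a * (17 / 64) := by
      refine abs_le_of_sq_le_sq (hB.trans ?_) (by positivity)
      rw [mul_pow (n * a)]
      refine mul_le_mul_of_nonneg_left ?_ (sq_nonneg _)
      calc (e ⬝ᵥ e) * ((u + v) ⬝ᵥ (u + v)) ≤ 1 / 64 * (289 / 64) :=
            mul_le_mul hvu hgg (dotProduct_self_nonneg' _) (by norm_num)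
        _ = _ := by norm_num
    have hQ : X *ᵥ u ⬝ᵥ X *ᵥ u - n = (X *ᵥ v ⬝ᵥ X *ᵥ v - n * (v ⬝ᵥ v))
        + (X *ᵥ e ⬝ᵥ X *ᵥ (u + v) - n * (e ⬝ᵥ (u + v))) := by
      rw [he]
      simp only [mulVec_add, mulVec_sub, dotProduct_add, sub_dotProduct, hu1,
        dotProduct_comm v u, dotProduct_comm (X *ᵥ v) (X *ᵥ u)]
      ring
    rw [hQ]
    refine (abs_add_le _ _).trans ?_
    have h1 := h v hv
    have h2 : n * τ * (v ⬝ᵥ v) ≤ n * τ * (81 / 64) := by gcongr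
    linarith
  set A : Set ℝ := {a | 0 ≤ a ∧ IsNearIsometryOn X a D} with hA
  obtain ⟨a₀, ha₀⟩ := exists_isNearIsometryOn X hn D
  have hbdd : BddBelow A := ⟨0, fun a ha => ha.1⟩
  have hne : A.Nonempty := ⟨a₀, ha₀⟩
  -- The infimum is at most the fixed point `81 τ / 47`. The strict inequality provides an
  -- admissible constant without the infimum being attained.
  have hinf : sInf A < 2 * τ := by
    have h1 : ∀ a ∈ A, sInf A ≤ 81 / 64 * τ + 17 / 64 * a := fun a ha =>
      csInf_le hbdd ⟨by have := ha.1; positivity, step a ha.1 ha.2⟩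
    have h2 : 64 / 17 * (sInf A - 81 / 64 * τ) ≤ sInf A :=
      le_csInf hne fun a ha => by linarith [h1 a ha]
    linarith
  obtain ⟨a, ha, hlt⟩ := exists_lt_of_csInf_lt hne hinf
  exact ha.2.mono hlt.le

end Net

/-! ### Gaussian tails and chi-square concentration. -/

section Concentration

/-- The standard Gaussian measure on `ℝ^ι`. -/
noncomputable def gaussianPi (ι : Type*) [Fintype ι] : Measure (ι → ℝ) :=
  Measure.pi fun _ => gaussianReal 0 1

instance (ι : Type*) [Fintype ι] : IsProbabilityMeasure (gaussianPi ι) := by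
  unfold gaussianPi; infer_instance

/-- The law of an `n × p` matrix with independent standard Gaussian entries. -/
noncomputable def gaussianDesign (n p : ℕ) : Measure (Fin n → Fin p → ℝ) :=
  Measure.pi fun _ => gaussianPi (Fin p)

instance (n p : ℕ) : IsProbabilityMeasure (gaussianDesign n p) := by
  unfold gaussianDesign; infer_instance

variable {ι : Type*} [Fintype ι]

lemma map_eval_gaussianPi (i : ι) : (gaussianPi ι).map (fun x => x i) = gaussianReal 0 1 :=
  (measurePreserving_eval (fun _ : ι => gaussianReal 0 1) i).map_eq

lemma iIndepFun_mul_gaussianPi (v : ι → ℝ) :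
    iIndepFun (fun i (x : ι → ℝ) => v i * x i) (gaussianPi ι) :=
  iIndepFun_pi (X := fun i (x : ℝ) => v i * x) fun i => by fun_prop

lemma map_mul_gaussianPi (v : ι → ℝ) (i : ι) :
    (gaussianPi ι).map (fun x => v i * x i) = gaussianReal 0 (Real.toNNReal (v i ^ 2)) := by
  have h : (fun x : ι → ℝ => v i * x i) = (fun y => v i * y) ∘ fun x => x i := rfl
  rw [h, ← Measure.map_map (by fun_prop) (by fun_prop), map_eval_gaussianPi,
    gaussianReal_map_const_mul]
  congr 1
  · simp
  · ext; simp [sq_nonneg]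

lemma map_dotProduct_gaussianPi (v : ι → ℝ) :
    (gaussianPi ι).map (fun x => v ⬝ᵥ x) = gaussianReal 0 (Real.toNNReal (v ⬝ᵥ v)) := by
  classical
  have key : ∀ s : Finset ι, (gaussianPi ι).map (∑ i ∈ s, fun x : ι → ℝ => v i * x i)
      = gaussianReal 0 (∑ i ∈ s, Real.toNNReal (v i ^ 2)) := by
    intro s
    induction s using Finset.induction_on with
    | empty =>
      simp only [Finset.sum_empty, gaussianReal_zero_var]
      have : (0 : (ι → ℝ) → ℝ) = fun _ => 0 := rfl
      rw [this, Measure.map_const]; simp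
    | insert i s hi ih =>
      rw [Finset.sum_insert hi, Finset.sum_insert hi, add_comm, add_comm (Real.toNNReal _)]
      have hind := (iIndepFun_mul_gaussianPi v).indepFun_finsetSum_of_notMem
        (fun i => by fun_prop) hi
      simpa using gaussianReal_add_gaussianReal_of_indepFun hind ih (map_mul_gaussianPi v i)
  have h1 := key Finset.univ
  have e : (∑ i, fun x : ι → ℝ => v i * x i) = fun x => v ⬝ᵥ x := by
    funext x; simp [dotProduct]
  rw [e] at h1
  rw [h1]
  congr 1
  rw [← Real.toNNReal_sum_of_nonneg fun i _ => sq_nonneg _]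
  simp [dotProduct, sq]

lemma hasSubgaussianMGF_dotProduct (v : ι → ℝ) :
    HasSubgaussianMGF (fun x => v ⬝ᵥ x) (Real.toNNReal (v ⬝ᵥ v)) (gaussianPi ι) := by
  have h := map_dotProduct_gaussianPi v
  have hm : Measurable fun x : ι → ℝ => v ⬝ᵥ x := by unfold dotProduct; fun_prop
  refine ⟨fun t => ?_, fun t => ?_⟩
  · have : Integrable (fun y => Real.exp (t * y)) ((gaussianPi ι).map fun x => v ⬝ᵥ x) := by
      rw [h]; exact integrable_exp_mul_gaussianReal t
    exact this.comp_measurable hm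
  · rw [mgf_gaussianReal h]; simp

/-- The two-sided Gaussian tail of a linear form whose coefficient vector has norm at most `σ`. -/
lemma gaussianPi_abs_dotProduct_ge_le (v : ι → ℝ) {σ x : ℝ} (hv : v ⬝ᵥ v ≤ σ ^ 2)
    (hx : 0 ≤ x) :
    (gaussianPi ι).real {w | x ≤ |v ⬝ᵥ w|} ≤ 2 * Real.exp (-(x ^ 2 / (2 * σ ^ 2))) := by
  rcases (dotProduct_self_nonneg' v).eq_or_lt with h0 | h0
  · rw [dotProduct_self_eq_zero.1 h0.symm]
    rcases hx.eq_or_lt with rfl | hx'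
    · have : (gaussianPi ι).real {w | (0 : ℝ) ≤ |(0 : ι → ℝ) ⬝ᵥ w|} ≤ 1 := measureReal_le_one
      refine this.trans ?_; norm_num
    · simp [not_le.2 hx']; positivity
  have hsub := hasSubgaussianMGF_dotProduct v
  have h1 := hsub.measure_ge_le hx
  have h2 := hsub.neg.measure_ge_le hx
  have hexp : Real.exp (-x ^ 2 / (2 * (Real.toNNReal (v ⬝ᵥ v) : ℝ)))
      ≤ Real.exp (-(x ^ 2 / (2 * σ ^ 2))) := by
    rw [Real.coe_toNNReal _ h0.le, neg_div]
    gcongr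
  have hset : {w | x ≤ |v ⬝ᵥ w|} ⊆ {w | x ≤ v ⬝ᵥ w} ∪ {w | x ≤ (-fun w => v ⬝ᵥ w) w} := by
    intro w hw
    simp only [Set.mem_ofPred_eq] at hw
    exact le_abs.1 hw
  calc (gaussianPi ι).real {w | x ≤ |v ⬝ᵥ w|} ≤ _ := measureReal_mono hset
    _ ≤ _ := measureReal_union_le _ _
    _ ≤ _ := by linarith

lemma gaussianReal_integrable_exp_sq {t : ℝ} (ht : t < 1 / 2) :
    Integrable (fun x => Real.exp (t * x ^ 2)) (gaussianReal 0 1) ∧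
      ∫ x, Real.exp (t * x ^ 2) ∂(gaussianReal 0 1) = (√(1 - 2 * t))⁻¹ := by
  have e : ∀ x : ℝ, gaussianPDFReal 0 1 x * Real.exp (t * x ^ 2)
      = (√(2 * Real.pi))⁻¹ * Real.exp (-(1 / 2 - t) * x ^ 2) := by
    intro x
    rw [gaussianPDFReal, mul_assoc, ← Real.exp_add]
    simp only [NNReal.coe_one, mul_one, sub_zero]
    congr 2; ring
  constructor
  · rw [gaussianReal_of_var_ne_zero 0 one_ne_zero, gaussianPDF_def,
      integrable_withDensity_iff_integrable_smul' (by fun_prop) (by simp)]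
    simp only [ENNReal.toReal_ofReal (gaussianPDFReal_nonneg _ _ _), smul_eq_mul, e]
    exact (integrable_exp_neg_mul_sq (by linarith)).const_mul _
  · rw [integral_gaussianReal_eq_integral_smul one_ne_zero]
    simp only [smul_eq_mul, e]
    rw [integral_const_mul, integral_gaussian, ← Real.sqrt_inv, ← Real.sqrt_inv,
      ← Real.sqrt_mul (by positivity)]
    congr 1
    have : (1 - 2 * t) ≠ 0 := by linarith
    have h2 : (1 / 2 - t) ≠ 0 := by linarith
    have h3 : 1 / 2 - t = (1 - 2 * t) / 2 := by ring
    rw [h3]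
    field_simp

/-- The first-order expansion of `log (1 - 2t)` has remainder at most `8 t²` when `|2t| ≤ 1 / 2`,
and the square root halves it. The linear term cancels after centering the squared Gaussian. -/
lemma inv_sqrt_one_sub_le {t : ℝ} (ht : |t| ≤ 1 / 4) :
    (√(1 - 2 * t))⁻¹ ≤ Real.exp (t + 4 * t ^ 2) := by
  have ht' := abs_le.1 ht
  have hpos : 0 < 1 - 2 * t := by linarith
  have hx : |2 * t| ≤ 1 / 2 := by rw [abs_mul, abs_two]; linarith
  have h := Real.abs_log_sub_add_sum_range_le (x := 2 * t) (by linarith) 1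
  simp only [Finset.sum_range_one, Nat.cast_zero, zero_add, pow_one, div_one] at h
  have h1 := (abs_le.1 h).1
  have h2 : |2 * t| ^ (1 + 1) / (1 - |2 * t|) ≤ 8 * t ^ 2 := by
    rw [div_le_iff₀ (by linarith)]
    have : |2 * t| ^ (1 + 1) = 4 * t ^ 2 := by rw [one_add_one_eq_two, sq_abs]; ring
    rw [this]; nlinarith [sq_nonneg t]
  have h3 : -(2 * (t + 4 * t ^ 2)) ≤ Real.log (1 - 2 * t) := by linarith
  have h4 : Real.exp (-(t + 4 * t ^ 2)) ≤ √(1 - 2 * t) := by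
    refine Real.le_sqrt_of_sq_le ?_
    rw [← Real.exp_nat_mul, ← Real.le_log_iff_exp_le hpos]
    push_cast; linarith
  rw [show Real.exp (t + 4 * t ^ 2) = (Real.exp (-(t + 4 * t ^ 2)))⁻¹ by
    rw [Real.exp_neg, inv_inv]]
  exact inv_anti₀ (Real.exp_pos _) h4

lemma gaussianReal_map_sqrt_mul {a : ℝ} (ha : 0 ≤ a) :
    (gaussianReal 0 1).map (fun y => √a * y) = gaussianReal 0 (Real.toNNReal a) := by
  rw [gaussianReal_map_const_mul]
  congr 1
  · simp
  · ext; simp [Real.sq_sqrt ha, ha]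

/-- The moment generating function of a centered squared Gaussian linear form. -/
lemma mgf_sq_dotProduct_le (v : ι → ℝ) {t : ℝ} (ht : |t * (v ⬝ᵥ v)| ≤ 1 / 4) :
    Integrable (fun x => Real.exp (t * ((v ⬝ᵥ x) ^ 2 - v ⬝ᵥ v))) (gaussianPi ι) ∧
      ∫ x, Real.exp (t * ((v ⬝ᵥ x) ^ 2 - v ⬝ᵥ v)) ∂(gaussianPi ι)
        ≤ Real.exp (4 * (t * (v ⬝ᵥ v)) ^ 2) := by
  set a := v ⬝ᵥ v with ha
  have ha0 : 0 ≤ a := dotProduct_self_nonneg' v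
  have hm : Measurable fun x : ι → ℝ => v ⬝ᵥ x := by unfold dotProduct; fun_prop
  have hmap : (gaussianPi ι).map (fun x => v ⬝ᵥ x) = (gaussianReal 0 1).map fun y => √a * y := by
    rw [gaussianReal_map_sqrt_mul ha0, map_dotProduct_gaussianPi]
  set f : ℝ → ℝ := fun y => Real.exp (t * (y ^ 2 - a)) with hf
  have hfm : Measurable f := by fun_prop
  have hcomp : (fun y => f (√a * y))
      = fun y => Real.exp (-(t * a)) * Real.exp ((t * a) * y ^ 2) := by
    funext y
    rw [hf, ← Real.exp_add]
    simp only [mul_pow, Real.sq_sqrt ha0]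
    congr 1; ring
  have hta := abs_le.1 ht
  obtain ⟨h1, h2⟩ := gaussianReal_integrable_exp_sq (t := t * a) (by linarith)
  have hint : Integrable (fun y => f (√a * y)) (gaussianReal 0 1) := by
    rw [hcomp]; exact h1.const_mul _
  constructor
  · have : Integrable f ((gaussianPi ι).map fun x => v ⬝ᵥ x) := by
      rw [hmap, integrable_map_measure hfm.aestronglyMeasurable (by fun_prop)]
      exact hint
    exact this.comp_measurable hm
  · have e : ∫ x, Real.exp (t * ((v ⬝ᵥ x) ^ 2 - a)) ∂(gaussianPi ι)
        = ∫ y, f (√a * y) ∂(gaussianReal 0 1) := by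
      rw [← integral_map (f := f) (φ := fun y => √a * y) (by fun_prop)
        hfm.aestronglyMeasurable, ← hmap, integral_map hm.aemeasurable hfm.aestronglyMeasurable]
    rw [e, hcomp, integral_const_mul, h2]
    calc Real.exp (-(t * a)) * (√(1 - 2 * (t * a)))⁻¹
        ≤ Real.exp (-(t * a)) * Real.exp (t * a + 4 * (t * a) ^ 2) := by
          gcongr; exact inv_sqrt_one_sub_le ht
      _ = _ := by rw [← Real.exp_add]; congr 1; ring

variable {n p : ℕ}

/-- Concentration of `‖X v‖²` around `n ‖v‖²`. -/
lemma gaussianDesign_normSq_sub_gt_le (v : Fin p → ℝ) {τ : ℝ} (hτ0 : 0 < τ) (hτ : τ ≤ 1) :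
    (gaussianDesign n p).real {X | n * τ * (v ⬝ᵥ v)
      < |(X : Matrix (Fin n) (Fin p) ℝ) *ᵥ v ⬝ᵥ X *ᵥ v - n * (v ⬝ᵥ v)|}
      ≤ 2 * Real.exp (-(n * τ ^ 2 / 16)) := by
  set a := v ⬝ᵥ v with ha
  rcases (dotProduct_self_nonneg' v).eq_or_lt with h0 | h0
  · have hv := dotProduct_self_eq_zero.1 h0.symm
    have : {X : Fin n → Fin p → ℝ | n * τ * a
      < |(X : Matrix (Fin n) (Fin p) ℝ) *ᵥ v ⬝ᵥ X *ᵥ v - n * a|} = ∅ := by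
      ext X
      have : (X : Matrix (Fin n) (Fin p) ℝ) *ᵥ (0 : Fin p → ℝ) = 0 := mulVec_zero _
      simp [ha, hv, this]
    rw [this]; simp; positivity
  set Q : Fin n → (Fin n → Fin p → ℝ) → ℝ := fun i X => (v ⬝ᵥ X i) ^ 2 - a with hQ
  have hfm : Measurable fun x : Fin p → ℝ => (v ⬝ᵥ x) ^ 2 - a := by
    unfold dotProduct; fun_prop
  have hQm : ∀ i, Measurable (Q i) := fun i => hfm.comp (measurable_pi_apply i)
  have hind : iIndepFun Q (gaussianDesign n p) :=
    iIndepFun_pi (X := fun _ (x : Fin p → ℝ) => (v ⬝ᵥ x) ^ 2 - a) fun i => hfm.aemeasurable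
  have hpres : ∀ i : Fin n, MeasurePreserving (fun X : Fin n → Fin p → ℝ => X i)
      (gaussianDesign n p) (gaussianPi (Fin p)) := fun i =>
    measurePreserving_eval (fun _ : Fin n => gaussianPi (Fin p)) i
  have hone : ∀ t : ℝ, |t * a| ≤ 1 / 4 → ∀ i,
      Integrable (fun X => Real.exp (t * Q i X)) (gaussianDesign n p) ∧
        mgf (Q i) (gaussianDesign n p) t ≤ Real.exp (4 * (t * a) ^ 2) := by
    intro t ht i
    obtain ⟨h1, h2⟩ := mgf_sq_dotProduct_le v ht
    refine ⟨(hpres i).integrable_comp_of_integrable h1, ?_⟩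
    refine le_trans (le_of_eq ?_) h2
    rw [mgf, ← (hpres i).map_eq, integral_map (hpres i).measurable.aemeasurable]
    exact ((hfm.const_mul t).exp).aestronglyMeasurable
  have hmgf : ∀ t : ℝ, |t * a| ≤ 1 / 4 →
      mgf (∑ i, Q i) (gaussianDesign n p) t ≤ Real.exp (n * (4 * (t * a) ^ 2)) := by
    intro t ht
    rw [hind.mgf_sum hQm]
    calc ∏ i, mgf (Q i) (gaussianDesign n p) t ≤ ∏ i : Fin n, Real.exp (4 * (t * a) ^ 2) :=
          Finset.prod_le_prod (fun i _ => mgf_nonneg) fun i _ => (hone t ht i).2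
      _ = _ := by
        rw [Finset.prod_const, Finset.card_univ, Fintype.card_fin, ← Real.exp_nat_mul]
  have hint : ∀ t : ℝ, |t * a| ≤ 1 / 4 →
      Integrable (fun X => Real.exp (t * (∑ i, Q i) X)) (gaussianDesign n p) := fun t ht =>
    hind.integrable_exp_mul_sum hQm fun i _ => (hone t ht i).1
  -- The minimizer of the Chernoff exponent `-n τ (t a) + 4 n (t a)²`, with value `-n τ² / 16`.
  set t := τ / (8 * a) with ht
  have hta : t * a = τ / 8 := by rw [ht]; have : a ≠ 0 := h0.ne'; field_simp
  have ht0 : 0 ≤ t := by rw [ht]; positivity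
  have ht1 : |t * a| ≤ 1 / 4 := by rw [hta, abs_of_pos (by positivity)]; linarith
  have ht2 : |-t * a| ≤ 1 / 4 := by rw [neg_mul, abs_neg]; exact ht1
  have hup := measure_ge_le_exp_mul_mgf (n * τ * a) ht0 (hint t ht1)
  have hlo := measure_le_le_exp_mul_mgf (-(n * τ * a)) (neg_nonpos.2 ht0) (hint (-t) ht2)
  have hup' : Real.exp (-t * (n * τ * a)) * mgf (∑ i, Q i) (gaussianDesign n p) t
      ≤ Real.exp (-(n * τ ^ 2 / 16)) := by
    refine (mul_le_mul_of_nonneg_left (hmgf t ht1) (Real.exp_pos _).le).trans (le_of_eq ?_)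
    rw [← Real.exp_add, hta]
    congr 1
    have : -t * (n * τ * a) = -(t * a) * (n * τ) := by ring
    rw [this, hta]; ring
  have hlo' : Real.exp (- -t * -(n * τ * a)) * mgf (∑ i, Q i) (gaussianDesign n p) (-t)
      ≤ Real.exp (-(n * τ ^ 2 / 16)) := by
    refine (mul_le_mul_of_nonneg_left (hmgf (-t) ht2) (Real.exp_pos _).le).trans (le_of_eq ?_)
    rw [← Real.exp_add, neg_mul t a, hta]
    congr 1
    have : - -t * -(n * τ * a) = -(t * a) * (n * τ) := by ring
    rw [this, hta]; ring
  have hsum : ∀ X : Fin n → Fin p → ℝ,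
      (X : Matrix (Fin n) (Fin p) ℝ) *ᵥ v ⬝ᵥ X *ᵥ v - n * a = (∑ i, Q i) X := by
    intro X
    rw [Finset.sum_apply]
    simp only [hQ, Finset.sum_sub_distrib, Finset.sum_const, Finset.card_univ, Fintype.card_fin,
      nsmul_eq_mul]
    congr 1
    exact Finset.sum_congr rfl fun i _ => by
      rw [sq, dotProduct_comm v (X i)]; rfl
  have hset : {X : Fin n → Fin p → ℝ | n * τ * a
      < |(X : Matrix (Fin n) (Fin p) ℝ) *ᵥ v ⬝ᵥ X *ᵥ v - n * a|}
      ⊆ {X | n * τ * a ≤ (∑ i, Q i) X} ∪ {X | (∑ i, Q i) X ≤ -(n * τ * a)} := by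
    intro X hX
    simp only [Set.mem_ofPred_eq, hsum] at hX
    rcases lt_abs.1 hX with h | h
    · exact Or.inl h.le
    · exact Or.inr (by simp only [Set.mem_ofPred_eq]; linarith)
  calc _ ≤ _ := measureReal_mono hset
    _ ≤ _ := measureReal_union_le _ _
    _ ≤ _ := by linarith

end Concentration

/-! ### Product form of the joint law of design and noise. -/

section JointLaw

variable {n p : ℕ}

/-- Grouping the entries by rows gives the form used by the concentration bound, where `‖X v‖²` is a
sum over independent rows. -/
lemma map_curry_gaussianPi (n p : ℕ) :
    (gaussianPi (Fin n × Fin p)).map (fun x i j => x (i, j)) = gaussianDesign n p := by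
  have hind : iIndepFun (fun (e : Fin n × Fin p) (X : Fin n → Fin p → ℝ) => X e.1 e.2)
      (gaussianDesign n p) := by
    have := iIndepFun_uncurry_infinitePi' (X := fun (_ : Fin n) (_ : Fin p) (x : ℝ) => x)
      (fun (_ : Fin n) (_ : Fin p) => gaussianReal 0 1) (fun _ _ => measurable_id)
    simpa only [Measure.infinitePi_eq_pi, gaussianDesign, gaussianPi] using this
  have hmap : ∀ e : Fin n × Fin p,
      (gaussianDesign n p).map (fun X => X e.1 e.2) = gaussianReal 0 1 := by
    intro e
    have h : (fun X : Fin n → Fin p → ℝ => X e.1 e.2) = (fun x => x e.2) ∘ fun X => X e.1 := rfl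
    rw [h, ← Measure.map_map (by fun_prop) (by fun_prop)]
    have := (measurePreserving_eval (fun _ : Fin n => gaussianPi (Fin p)) e.1).map_eq
    change ((gaussianDesign n p).map (Function.eval e.1)).map _ = _
    rw [gaussianDesign, this, map_eval_gaussianPi]
  have h1 := hind.map_fun_eq_pi_map fun e => Measurable.aemeasurable (by fun_prop)
  simp only [hmap] at h1
  rw [gaussianPi, ← h1, Measure.map_map (by fun_prop) (by fun_prop)]
  exact Measure.map_id

/-- The joint law of the design and the noise. -/
lemma IsGaussianDesign.map_eq {Ω : Type*} [MeasurableSpace Ω] {P : Measure Ω}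
    {X : Ω → Matrix (Fin n) (Fin p) ℝ} {w : Ω → Fin n → ℝ} (h : IsGaussianDesign P X w) :
    AEMeasurable (fun ω => ((fun i j => X ω i j : Fin n → Fin p → ℝ), w ω)) P ∧
      P.map (fun ω => ((fun i j => X ω i j : Fin n → Fin p → ℝ), w ω))
        = (gaussianDesign n p).prod (gaussianPi (Fin n)) := by
  set f : (Fin n × Fin p) ⊕ Fin n → Ω → ℝ :=
    Sum.elim (fun (e : Fin n × Fin p) (ω : Ω) => X ω e.1 e.2) (fun (i : Fin n) (ω : Ω) => w ω i)
    with hf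
  have hlaw : ∀ e, HasLaw (f e) (gaussianReal 0 1) P := by
    rintro (e | i)
    · exact h.law_design e.1 e.2
    · exact h.law_noise i
  have hm : ∀ e, AEMeasurable (f e) P := fun e => (hlaw e).aemeasurable
  have hfm : AEMeasurable (fun ω e => f e ω) P := aemeasurable_pi_lambda _ hm
  have h1 : P.map (fun ω e => f e ω) = Measure.pi fun _ => gaussianReal 0 1 := by
    rw [h.indep.map_fun_eq_pi_map hm]
    congr 1
    funext e
    exact (hlaw e).map_eq
  set g : ((Fin n × Fin p) ⊕ Fin n → ℝ) → (Fin n → Fin p → ℝ) × (Fin n → ℝ) :=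
    Prod.map (fun x i j => x (i, j)) id ∘
      (MeasurableEquiv.sumPiEquivProdPi fun _ : (Fin n × Fin p) ⊕ Fin n => ℝ) with hg
  have hcurry : Measurable fun (x : Fin n × Fin p → ℝ) i j => x (i, j) := by fun_prop
  have hgm : Measurable g :=
    (hcurry.prodMap measurable_id).comp (MeasurableEquiv.measurable _)
  have hcomp : (fun ω => ((fun i j => X ω i j : Fin n → Fin p → ℝ), w ω))
      = g ∘ fun ω e => f e ω := rfl
  rw [hcomp]
  refine ⟨hgm.comp_aemeasurable hfm, ?_⟩
  rw [← AEMeasurable.map_map_of_aemeasurable hgm.aemeasurable hfm, h1, hg,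
    ← Measure.map_map (hcurry.prodMap measurable_id) (MeasurableEquiv.measurable _),
    (measurePreserving_sumPiEquivProdPi fun _ : (Fin n × Fin p) ⊕ Fin n => gaussianReal 0 1).map_eq]
  change ((gaussianPi (Fin n × Fin p)).prod (gaussianPi (Fin n))).map _ = _
  rw [← Measure.map_prod_map _ _ hcurry measurable_id, map_curry_gaussianPi, Measure.map_id]

/-- Conditioning by Tonelli: with the design frozen, the noise meets a fixed direction, and a bound
uniform over designs integrates to itself. -/
lemma prod_measureReal_le {α β : Type*} [MeasurableSpace α] [MeasurableSpace β] {μ : Measure α}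
    {ν : Measure β} [IsProbabilityMeasure μ] [IsProbabilityMeasure ν] {A : Set (α × β)}
    (hA : MeasurableSet A) {c : ℝ} (h : ∀ x, ν.real {y | (x, y) ∈ A} ≤ c) :
    (μ.prod ν).real A ≤ c := by
  obtain ⟨x₀⟩ : Nonempty α := nonempty_of_isProbabilityMeasure μ
  have hc : 0 ≤ c := measureReal_nonneg.trans (h x₀)
  rw [measureReal_def, Measure.prod_apply hA]
  refine ENNReal.toReal_le_of_le_ofReal hc ?_
  calc ∫⁻ x, ν (Prod.mk x ⁻¹' A) ∂μ ≤ ∫⁻ _, ENNReal.ofReal c ∂μ := by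
        refine lintegral_mono fun x => ?_
        have := h x
        rw [measureReal_def] at this
        exact (ENNReal.le_ofReal_iff_toReal_le (measure_ne_top _ _) hc).2 this
    _ = ENNReal.ofReal c := by simp

end JointLaw

/-! ### Measurability and probability of the good event. -/

section Events

variable {n p : ℕ}

lemma measurable_normSq_mulVec (v : Fin p → ℝ) :
    Measurable fun X : Fin n → Fin p → ℝ => (X : Matrix (Fin n) (Fin p) ℝ) *ᵥ v ⬝ᵥ X *ᵥ v := by
  unfold mulVec dotProduct; fun_prop

lemma continuous_maskedGram (S : Finset (Fin p)) :
    Continuous fun X : Fin n → Fin p → ℝ => maskedGram (X : Matrix (Fin n) (Fin p) ℝ) S := by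
  refine continuous_matrix fun j l => ?_
  unfold maskedGram gram
  split_ifs <;> fun_prop

/-- Adjugate over determinant. At singular matrices the matrix inverse and the scalar inverse of the
determinant are both zero by convention, so no exceptional set arises. -/
lemma measurable_inv_maskedGram (S : Finset (Fin p)) (a b : Fin p) :
    Measurable fun X : Fin n → Fin p → ℝ =>
      (maskedGram (X : Matrix (Fin n) (Fin p) ℝ) S)⁻¹ a b := by
  have e : (fun X : Fin n → Fin p → ℝ => (maskedGram (X : Matrix (Fin n) (Fin p) ℝ) S)⁻¹ a b)
      = fun X => ((maskedGram (X : Matrix (Fin n) (Fin p) ℝ) S).det)⁻¹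
        * (maskedGram (X : Matrix (Fin n) (Fin p) ℝ) S).adjugate a b := by
    funext X
    rw [Matrix.inv_def, Ring.inverse_eq_inv']; rfl
  rw [e]
  have hc := continuous_maskedGram (n := n) S
  exact (hc.matrix_det.measurable.inv).mul
    ((hc.matrix_adjugate.matrix_elem a b).measurable)

lemma measurable_noiseDir_dotProduct (S : Finset (Fin p)) (j : Fin p) :
    Measurable fun x : (Fin n → Fin p → ℝ) × (Fin n → ℝ) =>
      noiseDir (x.1 : Matrix (Fin n) (Fin p) ℝ) S j ⬝ᵥ x.2 := by
  have hinv : ∀ a b, Measurable fun x : (Fin n → Fin p → ℝ) × (Fin n → ℝ) =>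
      (maskedGram (x.1 : Matrix (Fin n) (Fin p) ℝ) S)⁻¹ a b := fun a b =>
    (measurable_inv_maskedGram S a b).comp measurable_fst
  have hrow : ∀ l, Measurable fun x : (Fin n → Fin p → ℝ) × (Fin n → ℝ) =>
      maskedRow (x.1 : Matrix (Fin n) (Fin p) ℝ) S j l := fun l => by
    unfold maskedRow gram
    split_ifs <;> fun_prop
  have hreg : ∀ l, Measurable fun x : (Fin n → Fin p → ℝ) × (Fin n → ℝ) =>
      maskedRegression (x.1 : Matrix (Fin n) (Fin p) ℝ) S j l := fun l => by
    change Measurable fun x : (Fin n → Fin p → ℝ) × (Fin n → ℝ) =>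
      ∑ r, (maskedGram (x.1 : Matrix (Fin n) (Fin p) ℝ) S)⁻¹ l r
        * maskedRow (x.1 : Matrix (Fin n) (Fin p) ℝ) S j r
    exact Finset.measurable_sum _ fun r _ => (hinv l r).mul (hrow r)
  refine Finset.measurable_sum _ fun i _ => Measurable.mul ?_ (by fun_prop)
  unfold noiseDir
  refine Measurable.mul ?_ (Measurable.sub (by fun_prop) ?_)
  · unfold colNorm; fun_prop
  · change Measurable fun x : (Fin n → Fin p → ℝ) × (Fin n → ℝ) =>
      ∑ l, x.1 i l * maskedRegression (x.1 : Matrix (Fin n) (Fin p) ℝ) S j l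
    exact Finset.measurable_sum _ fun l _ => Measurable.mul (by fun_prop) (hreg l)

lemma measurable_oracleLoss (s : ℕ) (lam α δ : ℝ) (β : Fin p → ℝ) (S : Finset (Fin p)) :
    Measurable fun x : (Fin n → Fin p → ℝ) × (Fin n → ℝ) =>
      oracleLoss s lam α δ β S (x.1 : Matrix (Fin n) (Fin p) ℝ) x.2 := by
  classical
  unfold oracleLoss
  refine Finset.measurable_sum _ fun j _ => Measurable.const_mul ?_ _
  refine Measurable.ite ?_ measurable_const measurable_const
  exact measurableSet_le measurable_const (measurable_noiseDir_dotProduct S j).abs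

/-- The designs that are nearly isometric on a net. -/
def netIsometric (n p m : ℕ) (τ : ℝ) : Set (Fin n → Fin p → ℝ) :=
  {X | ∀ v ∈ gridNet p (8 * m) m,
    |(X : Matrix (Fin n) (Fin p) ℝ) *ᵥ v ⬝ᵥ X *ᵥ v - n * (v ⬝ᵥ v)| ≤ n * τ * (v ⬝ᵥ v)}

lemma measurableSet_netIsometric (n p m : ℕ) (τ : ℝ) :
    MeasurableSet (netIsometric n p m τ) := by
  have : netIsometric n p m τ = ⋂ v ∈ gridNet p (8 * m) m,
      {X : Fin n → Fin p → ℝ | |(X : Matrix (Fin n) (Fin p) ℝ) *ᵥ v ⬝ᵥ X *ᵥ v - n * (v ⬝ᵥ v)|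
        ≤ n * τ * (v ⬝ᵥ v)} := by
    ext X; simp [netIsometric]
  rw [this]
  exact Finset.measurableSet_biInter _ fun v _ =>
    measurableSet_le ((measurable_normSq_mulVec v).sub_const _).abs measurable_const

lemma gaussianDesign_compl_netIsometric_le {m : ℕ} {τ : ℝ} (hτ0 : 0 < τ) (hτ : τ ≤ 1) :
    (gaussianDesign n p).real (netIsometric n p m τ)ᶜ
      ≤ ((p * (2 * (8 * m) + 1) + 1 : ℕ) : ℝ) ^ m * (2 * Real.exp (-(n * τ ^ 2 / 16))) := by
  have hsub : (netIsometric n p m τ)ᶜ ⊆ ⋃ v ∈ gridNet p (8 * m) m,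
      {X : Fin n → Fin p → ℝ | n * τ * (v ⬝ᵥ v)
      < |(X : Matrix (Fin n) (Fin p) ℝ) *ᵥ v ⬝ᵥ X *ᵥ v - n * (v ⬝ᵥ v)|} := by
    intro X hX
    simp only [netIsometric, Set.mem_compl_iff, Set.mem_ofPred_eq, not_forall, not_le] at hX
    obtain ⟨v, hv, h⟩ := hX
    simp only [Set.mem_iUnion]
    exact ⟨v, hv, h⟩
  calc (gaussianDesign n p).real (netIsometric n p m τ)ᶜ ≤ _ := measureReal_mono hsub (measure_ne_top _ _)
    _ ≤ _ := measureReal_biUnion_finset_le _ _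
    _ ≤ ∑ v ∈ gridNet p (8 * m) m, 2 * Real.exp (-(n * τ ^ 2 / 16)) :=
      Finset.sum_le_sum fun v _ => gaussianDesign_normSq_sub_gt_le v hτ0 hτ
    _ = (gridNet p (8 * m) m).card * (2 * Real.exp (-(n * τ ^ 2 / 16))) := by
      rw [Finset.sum_const, nsmul_eq_mul]
    _ ≤ _ := by
      have := card_gridNet_le p (8 * m) m
      gcongr
      exact_mod_cast this

/-- Given the design, the oracle loss is at most `e^a` times a bound on its expectation with
probability at least `1 - e^(-a)`. -/
lemma gaussianPi_oracleLoss_gt_le {s m : ℕ} {lam α δ a Bd : ℝ} {β : Fin p → ℝ}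
    {S : Finset (Fin p)} {X : Matrix (Fin n) (Fin p) ℝ}
    (hRI : RestrictedIsometry X m α) (hn : 0 < n) (hα0 : 0 ≤ α) (hα : α ≤ 1 / 2)
    (hS : S.card + 1 ≤ m) (hthr : ∀ j, 0 ≤ noiseThreshold n p s lam α δ (β j)) (hBd : 0 < Bd)
    (hsum : ∑ j, 8 * n * max |β j| lam ^ 2 *
      (2 * Real.exp (-(noiseThreshold n p s lam α δ (β j) ^ 2 / (2 * (1 + 4 * α) ^ 2))))
      ≤ Real.exp (-a) * Bd) :
    (gaussianPi (Fin n)).real {w | Bd < oracleLoss s lam α δ β S X w} ≤ Real.exp (-a) := by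
  classical
  have hmW : ∀ j, Measurable fun w : Fin n → ℝ => noiseDir X S j ⬝ᵥ w := fun j => by
    unfold dotProduct; fun_prop
  have hset : ∀ j, MeasurableSet
      {w | noiseThreshold n p s lam α δ (β j) ≤ |noiseDir X S j ⬝ᵥ w|} := fun j =>
    measurableSet_le measurable_const (hmW j).abs
  have hind : ∀ j, (fun w => if noiseThreshold n p s lam α δ (β j) ≤ |noiseDir X S j ⬝ᵥ w|
      then (1 : ℝ) else 0)
      = Set.indicator {w | noiseThreshold n p s lam α δ (β j) ≤ |noiseDir X S j ⬝ᵥ w|} 1 := by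
    intro j; funext w; simp [Set.indicator_apply]
  have hint1 : ∀ j, Integrable (fun w => if noiseThreshold n p s lam α δ (β j)
      ≤ |noiseDir X S j ⬝ᵥ w| then (1 : ℝ) else 0) (gaussianPi (Fin n)) := fun j => by
    rw [hind j]; exact (integrable_const 1).indicator (hset j)
  have hint : Integrable (fun w => oracleLoss s lam α δ β S X w) (gaussianPi (Fin n)) := by
    unfold oracleLoss
    exact integrable_finsetSum _ fun j _ => (hint1 j).const_mul _
  have h0 : ∀ w, 0 ≤ oracleLoss s lam α δ β S X w := fun w =>
    Finset.sum_nonneg fun j _ => by split_ifs <;> positivity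
  have hE : ∫ w, oracleLoss s lam α δ β S X w ∂(gaussianPi (Fin n)) ≤ Real.exp (-a) * Bd := by
    refine le_trans ?_ hsum
    unfold oracleLoss
    rw [integral_finsetSum _ fun j _ => (hint1 j).const_mul _]
    refine Finset.sum_le_sum fun j _ => ?_
    rw [integral_const_mul, hind j, integral_indicator_one (hset j)]
    refine mul_le_mul_of_nonneg_left ?_ (by positivity)
    exact gaussianPi_abs_dotProduct_ge_le _ (noiseDir_sq_le hRI hn hα0 hα hS j) (hthr j)
  -- Markov's inequality; the factor `exp (-a)` in `hsum` becomes the failure probability.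
  have hmark := mul_meas_ge_le_integral_of_nonneg (ae_of_all _ h0) hint Bd
  have hle : (gaussianPi (Fin n)).real {w | Bd < oracleLoss s lam α δ β S X w}
      ≤ (gaussianPi (Fin n)).real {w | Bd ≤ oracleLoss s lam α δ β S X w} :=
    measureReal_mono fun w hw => by
      simp only [Set.mem_ofPred_eq] at hw ⊢; exact hw.le
  refine hle.trans (le_of_mul_le_mul_left ?_ hBd)
  linarith

/-- With high probability the design is restrictedly isometric, the oracle noise is bounded and the
oracle loss is small. -/
lemma IsGaussianDesign.measureReal_not_good_le {Ω : Type*} [MeasurableSpace Ω] {P : Measure Ω}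
    {X : Ω → Matrix (Fin n) (Fin p) ℝ} {w : Ω → Fin n → ℝ} (h : IsGaussianDesign P X w)
    {s m : ℕ} {lam τ δ a Bd M : ℝ} {β : Fin p → ℝ} {S : Finset (Fin p)}
    (hn : 0 < n) (hτ0 : 0 < τ) (hτ : 2 * τ ≤ 1 / 2) (hM : 0 ≤ M)
    (hS : S.card + 1 ≤ m) (hthr : ∀ j, 0 ≤ noiseThreshold n p s lam (2 * τ) δ (β j))
    (hBd : 0 < Bd)
    (hsum : ∑ j, 8 * n * max |β j| lam ^ 2 * (2 * Real.exp
      (-(noiseThreshold n p s lam (2 * τ) δ (β j) ^ 2 / (2 * (1 + 4 * (2 * τ)) ^ 2))))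
      ≤ Real.exp (-a) * Bd) :
    P.real {ω | ¬ (RestrictedIsometry (X ω) m (2 * τ) ∧ (∀ j, |noiseDir (X ω) S j ⬝ᵥ w ω| ≤ M) ∧
      oracleLoss s lam (2 * τ) δ β S (X ω) (w ω) ≤ Bd)}
      ≤ ((p * (2 * (8 * m) + 1) + 1 : ℕ) : ℝ) ^ m * (2 * Real.exp (-(n * τ ^ 2 / 16)))
        + p * (2 * Real.exp (-(M ^ 2 / (2 * (1 + 4 * (2 * τ)) ^ 2)))) + Real.exp (-a) := by
  obtain ⟨hmeas, hmap⟩ := h.map_eq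
  set f : Ω → (Fin n → Fin p → ℝ) × (Fin n → ℝ) :=
    fun ω => ((fun i j => X ω i j : Fin n → Fin p → ℝ), w ω) with hf
  set N := netIsometric n p m τ with hN
  -- The net event is a finite intersection of measurable sets, and it stands in for the restricted
  -- isometry property in all measurability arguments.
  have hNRI : ∀ Y ∈ N, RestrictedIsometry (Y : Matrix (Fin n) (Fin p) ℝ) m (2 * τ) :=
    fun Y hY => RestrictedIsometry.of_gridNet hn (by omega) hτ0 hY
  set A1 : Set ((Fin n → Fin p → ℝ) × (Fin n → ℝ)) := {x | x.1 ∈ Nᶜ} with hA1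
  set A2 : Set ((Fin n → Fin p → ℝ) × (Fin n → ℝ)) :=
    ⋃ j, {x | x.1 ∈ N ∧ M < |noiseDir (x.1 : Matrix (Fin n) (Fin p) ℝ) S j ⬝ᵥ x.2|} with hA2
  set A3 : Set ((Fin n → Fin p → ℝ) × (Fin n → ℝ)) :=
    {x | x.1 ∈ N ∧ Bd < oracleLoss s lam (2 * τ) δ β S (x.1 : Matrix (Fin n) (Fin p) ℝ) x.2}
    with hA3
  have hNm : MeasurableSet N := measurableSet_netIsometric n p m τ
  have hA1m : MeasurableSet A1 := measurable_fst hNm.compl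
  have hA2m : ∀ j, MeasurableSet {x : (Fin n → Fin p → ℝ) × (Fin n → ℝ) |
      x.1 ∈ N ∧ M < |noiseDir (x.1 : Matrix (Fin n) (Fin p) ℝ) S j ⬝ᵥ x.2|} := fun j =>
    (measurable_fst hNm).inter
      (measurableSet_lt measurable_const (measurable_noiseDir_dotProduct S j).abs)
  have hA3m : MeasurableSet A3 := (measurable_fst hNm).inter
    (measurableSet_lt measurable_const (measurable_oracleLoss s lam (2 * τ) δ β S))
  have hAm : MeasurableSet (A1 ∪ A2 ∪ A3) :=
    (hA1m.union (MeasurableSet.iUnion hA2m)).union hA3m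
  have : IsProbabilityMeasure P := h.indep.isProbabilityMeasure
  have hsub : {ω | ¬ (RestrictedIsometry (X ω) m (2 * τ)
      ∧ (∀ j, |noiseDir (X ω) S j ⬝ᵥ w ω| ≤ M) ∧
      oracleLoss s lam (2 * τ) δ β S (X ω) (w ω) ≤ Bd)} ⊆ f ⁻¹' (A1 ∪ A2 ∪ A3) := by
    intro ω hω
    simp only [Set.mem_ofPred_eq] at hω
    by_contra hcon
    simp only [Set.mem_preimage, Set.mem_union, not_or, hA1, hA2, hA3, Set.mem_iUnion,
      Set.mem_ofPred_eq, Set.mem_compl_iff, not_not, not_exists, not_and, not_lt] at hcon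
    obtain ⟨⟨h1, h2⟩, h3⟩ := hcon
    exact hω ⟨hNRI _ h1, fun j => h2 j h1, h3 h1⟩
  have hP : P.real (f ⁻¹' (A1 ∪ A2 ∪ A3))
      = ((gaussianDesign n p).prod (gaussianPi (Fin n))).real (A1 ∪ A2 ∪ A3) := by
    rw [← hmap, measureReal_def, measureReal_def, Measure.map_apply_of_aemeasurable hmeas hAm]
  have hb1 : ((gaussianDesign n p).prod (gaussianPi (Fin n))).real A1
      ≤ ((p * (2 * (8 * m) + 1) + 1 : ℕ) : ℝ) ^ m * (2 * Real.exp (-(n * τ ^ 2 / 16))) := by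
    have : A1 = Nᶜ ×ˢ Set.univ := by ext x; simp [hA1]
    rw [this, measureReal_prod_prod]
    simpa using gaussianDesign_compl_netIsometric_le (n := n) (p := p) (m := m) hτ0 (by linarith)
  have hb2 : ((gaussianDesign n p).prod (gaussianPi (Fin n))).real A2
      ≤ p * (2 * Real.exp (-(M ^ 2 / (2 * (1 + 4 * (2 * τ)) ^ 2)))) := by
    refine (measureReal_iUnion_fintype_le _).trans ?_
    refine (Finset.sum_le_sum fun j _ => prod_measureReal_le (hA2m j)
      (c := 2 * Real.exp (-(M ^ 2 / (2 * (1 + 4 * (2 * τ)) ^ 2)))) fun Y => ?_).trans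
        (le_of_eq ?_)
    · by_cases hY : Y ∈ N
      · refine le_trans (measureReal_mono fun w hw => ?_) (gaussianPi_abs_dotProduct_ge_le
          (noiseDir (Y : Matrix (Fin n) (Fin p) ℝ) S j)
          (noiseDir_sq_le (hNRI Y hY) hn (by linarith) hτ hS j) hM)
        simp only [Set.mem_ofPred_eq] at hw ⊢
        exact hw.2.le
      · simp only [Set.mem_ofPred_eq, hY, false_and]
        simp; positivity
    · rw [Finset.sum_const, Finset.card_univ, Fintype.card_fin, nsmul_eq_mul]
  have hb3 : ((gaussianDesign n p).prod (gaussianPi (Fin n))).real A3 ≤ Real.exp (-a) := by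
    refine prod_measureReal_le hA3m fun Y => ?_
    by_cases hY : Y ∈ N
    · refine le_trans (measureReal_mono fun w hw => ?_) (gaussianPi_oracleLoss_gt_le
        (S := S) (hNRI Y hY) hn (by linarith) hτ hS hthr hBd hsum)
      simp only [hA3, Set.mem_ofPred_eq] at hw ⊢
      exact hw.2
    · simp only [hA3, Set.mem_ofPred_eq, hY, false_and]
      simp; positivity
  calc _ ≤ _ := measureReal_mono hsub
    _ = _ := hP
    _ ≤ _ := measureReal_union_le _ _
    _ ≤ _ := by gcongr; exact (measureReal_union_le _ _).trans (add_le_add hb1 hb2)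

end Events

/-! ### Gaussian tails at the noise levels and the union bound over the net. -/

section Numerics

/-- The Gaussian tail at the threshold of a null coordinate; the `p - s` null coordinates contribute
like `s` coordinates. -/
lemma noiseThreshold_zero_tail {n p s : ℕ} {lam α δ γ : ℝ} (hn : 0 < n) (hlam : 0 < lam)
    (hs : 1 ≤ s) (hsp : 2 * s < p) (hα : 0 ≤ α) (hδ : 0 ≤ δ) (hγ : γ = 10 * (α + δ))
    (hγ1 : γ ≤ 1 / 2) :
    0 ≤ noiseThreshold n p s lam α δ 0 ∧
      ((p : ℝ) - s) * Real.exp (-(noiseThreshold n p s lam α δ 0 ^ 2 / (2 * (1 + 4 * α) ^ 2)))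
        ≤ s * Real.exp (-((1 - γ) * snr n p s lam ^ 2 / 2) + γ * Real.log p) := by
  have hn' : (0 : ℝ) < n := by exact_mod_cast hn
  have hs' : (1 : ℝ) ≤ s := by exact_mod_cast hs
  have hsp' : (2 : ℝ) * s < p := by exact_mod_cast hsp
  set g := √(n : ℝ) with hg
  have hg0 : 0 < g := Real.sqrt_pos.2 hn'
  set L := Real.log (((p : ℝ) - s) / s) with hL
  have hquot : 1 ≤ ((p : ℝ) - s) / s := by rw [le_div_iff₀ (by linarith)]; linarith
  have hL0 : 0 ≤ L := Real.log_nonneg hquot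
  have hLp : L ≤ Real.log p := by
    refine Real.log_le_log (by linarith) ?_
    rw [div_le_iff₀ (by linarith)]; nlinarith
  have hexpL : Real.exp L = ((p : ℝ) - s) / s := Real.exp_log (by linarith)
  set T := lam * g / 2 + L / (lam * g) with hT
  have hT0 : 0 ≤ T := by positivity
  -- `(a + b)² = (a - b)² + 4 a b` with `a b = L / 2`. The extra `2 L` turns the number `p - s = s
  -- exp L` of null coordinates into `s`; this is why the threshold contains the logarithm.
  have hT2 : T ^ 2 = snr n p s lam ^ 2 + 2 * L := by
    rw [hT, snr]; change _ = (lam * g / 2 - L / (lam * g)) ^ 2 + _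
    field_simp; ring
  have hthr : noiseThreshold n p s lam α δ 0 = (1 - 2 * δ) * (1 - α) * T := by
    rw [noiseThreshold, if_pos rfl]
  have hα1 : α ≤ 1 / 20 := by linarith
  have hδ1 : δ ≤ 1 / 20 := by linarith
  have h0 : 0 ≤ (1 - 2 * δ) * (1 - α) := mul_nonneg (by linarith) (by linarith)
  refine ⟨by rw [hthr]; positivity, ?_⟩
  -- The constant 10 in `γ` is chosen to absorb the first-order losses `8 α` from the variance and
  -- `4 δ + 2 α` from the threshold.
  have hratio : (1 - γ) * (1 + 4 * α) ^ 2 ≤ ((1 - 2 * δ) * (1 - α)) ^ 2 := by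
    have h1 : 1 - 2 * δ - α ≤ (1 - 2 * δ) * (1 - α) := by nlinarith [mul_nonneg hα hδ]
    have h2 : (1 - 2 * δ - α) ^ 2 ≤ ((1 - 2 * δ) * (1 - α)) ^ 2 :=
      pow_le_pow_left₀ (by linarith) h1 2
    refine le_trans ?_ h2
    rw [hγ]
    nlinarith [mul_nonneg hα hδ, mul_nonneg hα hα, mul_nonneg hδ hδ,
      mul_nonneg (mul_nonneg hα hα) hδ, mul_nonneg (mul_nonneg hα hα) hα]
  have hkey : (1 - γ) * T ^ 2 / 2 ≤
      noiseThreshold n p s lam α δ 0 ^ 2 / (2 * (1 + 4 * α) ^ 2) := by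
    rw [hthr, mul_pow, div_le_div_iff₀ (by norm_num) (by positivity)]
    nlinarith [mul_le_mul_of_nonneg_right hratio (sq_nonneg T)]
  have hps : ((p : ℝ) - s) = s * Real.exp L := by rw [hexpL]; field_simp
  rw [hps, mul_assoc, ← Real.exp_add]
  refine mul_le_mul_of_nonneg_left (Real.exp_le_exp.2 ?_) (Nat.cast_nonneg s)
  rw [hT2] at hkey
  have : γ * L ≤ γ * Real.log p := by
    refine mul_le_mul_of_nonneg_left hLp ?_; rw [hγ]; positivity
  nlinarith

/-- The Gaussian tail at the threshold of a coordinate in the support, weighted by the squared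
coefficient, is largest at the smallest coefficient. -/
lemma noiseThreshold_signal_tail {n p s : ℕ} {lam α δ γ β : ℝ} (hn : 0 < n) (hlam : 0 < lam)
    (hs : 1 ≤ s) (hsp : 2 * s < p) (hα : 0 ≤ α) (hδ : 0 ≤ δ) (hγ : γ = 10 * (α + δ))
    (hγ1 : γ ≤ 1 / 2) (hp : 1 ≤ Real.log p) (hγp : γ * Real.log p ≤ 1)
    (hsnr : 20 ≤ snr n p s lam) (hβ : lam ≤ |β|) :
    0 ≤ noiseThreshold n p s lam α δ β ∧
      |β| ^ 2 * Real.exp (-(noiseThreshold n p s lam α δ β ^ 2 / (2 * (1 + 4 * α) ^ 2)))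
        ≤ lam ^ 2 * Real.exp (-((1 - 3 * γ) * snr n p s lam ^ 2 / 2)
          + 2 * (γ * Real.log p) * snr n p s lam) := by
  have hn' : (0 : ℝ) < n := by exact_mod_cast hn
  have hs' : (1 : ℝ) ≤ s := by exact_mod_cast hs
  have hsp' : (2 : ℝ) * s < p := by exact_mod_cast hsp
  set g := √(n : ℝ) with hg
  have hg0 : 0 < g := Real.sqrt_pos.2 hn'
  set L := Real.log (((p : ℝ) - s) / s) with hL
  have hquot : 1 ≤ ((p : ℝ) - s) / s := by rw [le_div_iff₀ (by linarith)]; linarith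
  have hL0 : 0 ≤ L := Real.log_nonneg hquot
  have hLp : L ≤ Real.log p := by
    refine Real.log_le_log (by linarith) ?_
    rw [div_le_iff₀ (by linarith)]; nlinarith
  set Q := snr n p s lam with hQ
  set r := L / (lam * g) with hr
  have hr0 : 0 ≤ r := by positivity
  have hQr : Q = lam * g / 2 - r := rfl
  have ha : 40 ≤ lam * g := by linarith
  have hγ0 : 0 ≤ γ := by rw [hγ]; positivity
  have hrp : r ≤ Real.log p := by
    rw [hr, div_le_iff₀ (by positivity)]
    nlinarith
  set T := lam * g / 2 + r with hT
  have hTQ : T ≤ Q + 2 * Real.log p := by rw [hT, hQr]; linarith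
  have hT0 : 0 ≤ T := by positivity
  set q := Q - γ * T with hq
  have hγT : γ * T ≤ γ * Q + 2 * (γ * Real.log p) := by
    have := mul_le_mul_of_nonneg_left hTQ hγ0; linarith
  have hq8 : 8 ≤ q := by
    have : γ * Q ≤ 1 / 2 * Q := by gcongr
    linarith
  -- The excess of the coefficient over its minimum, in noise units. The threshold grows at least
  -- like `y / 2` from its value near `Q` at `y = 0`.
  set y := g * (|β| - lam) with hy
  have hy0 : 0 ≤ y := mul_nonneg hg0.le (by linarith)
  have hβ0 : β ≠ 0 := by rintro rfl; simp at hβ; linarith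
  have hα1 : α ≤ 1 / 20 := by linarith
  have hδ1 : δ ≤ 1 / 20 := by linarith
  have hthr : noiseThreshold n p s lam α δ β
      = (1 - α) * (1 - δ) * y + (Q - α * T - (1 - α) * δ * (lam * g)) := by
    rw [noiseThreshold, if_neg hβ0, hQr, hT, hy, ← hg, ← hL, ← hr]; ring
  have hle : y / 2 + q ≤ noiseThreshold n p s lam α δ β := by
    rw [hthr]
    have h1 : (1 / 2 : ℝ) ≤ (1 - α) * (1 - δ) := by nlinarith
    have h2 : (1 - α) * δ * (lam * g) ≤ 2 * δ * T := by
      have h3 : δ * (lam * g) ≤ δ * (2 * T) := mul_le_mul_of_nonneg_left (by linarith) hδ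
      have h4 := mul_nonneg (mul_nonneg hα hδ) (show 0 ≤ lam * g by linarith)
      linarith
    have h4 : (α + 2 * δ) * T ≤ γ * T := by
      refine mul_le_mul_of_nonneg_right ?_ hT0; rw [hγ]; linarith
    linarith [mul_le_mul_of_nonneg_right h1 hy0]
  refine ⟨by linarith, ?_⟩
  have hratio : (1 - γ) * (1 + 4 * α) ^ 2 ≤ 1 := by
    have h1 : (1 - γ) * (1 + 4 * α) ^ 2 ≤ (1 - 10 * α) * (1 + 4 * α) ^ 2 := by
      refine mul_le_mul_of_nonneg_right ?_ (sq_nonneg _); rw [hγ]; linarith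
    nlinarith [mul_nonneg hα hα, mul_nonneg (mul_nonneg hα hα) hα]
  have hsq : (y / 2 + q) ^ 2 ≤ noiseThreshold n p s lam α δ β ^ 2 :=
    pow_le_pow_left₀ (by linarith) hle 2
  have hkey : (1 - γ) * (y / 2 + q) ^ 2 / 2 ≤
      noiseThreshold n p s lam α δ β ^ 2 / (2 * (1 + 4 * α) ^ 2) := by
    rw [le_div_iff₀ (by positivity)]
    have h1 := mul_le_mul_of_nonneg_right hratio (sq_nonneg (y / 2 + q))
    calc (1 - γ) * (y / 2 + q) ^ 2 / 2 * (2 * (1 + 4 * α) ^ 2)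
        = (1 - γ) * (1 + 4 * α) ^ 2 * (y / 2 + q) ^ 2 := by ring
      _ ≤ 1 * (y / 2 + q) ^ 2 := h1
      _ ≤ _ := by rw [one_mul]; exact hsq
  have hq2 : (1 - 3 * γ) * Q ^ 2 / 2 - 2 * (γ * Real.log p) * Q ≤ (1 - γ) * q ^ 2 / 2 := by
    have h1 : Q ^ 2 - 2 * Q * (γ * Q + 2 * (γ * Real.log p)) ≤ q ^ 2 := by
      have h3 := mul_le_mul_of_nonneg_left hγT (show 0 ≤ 2 * Q by linarith)
      have h4 : q ^ 2 = Q ^ 2 - 2 * Q * (γ * T) + (γ * T) ^ 2 := by rw [hq]; ring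
      linarith [sq_nonneg (γ * T)]
    have h2 : q ^ 2 ≤ Q ^ 2 := by
      refine pow_le_pow_left₀ (by linarith) ?_ 2
      rw [hq]; have := mul_nonneg hγ0 hT0; linarith
    linarith [mul_le_mul_of_nonneg_left h2 hγ0]
  -- The gain in the Gaussian exponent pays for the growth of the weight, `|β|² ≤ lam² exp (2 y)`;
  -- `q ≥ 8` makes the cross term large enough.
  have hcross : 2 * y ≤ (1 - γ) * (y / 2 + q) ^ 2 / 2 - (1 - γ) * q ^ 2 / 2 := by
    have h1 : (1 - γ) * (y / 2 + q) ^ 2 / 2 - (1 - γ) * q ^ 2 / 2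
        = (1 - γ) * (y ^ 2 / 8 + y * q / 2) := by ring
    rw [h1]
    have h2 : 4 * y ≤ y ^ 2 / 8 + y * q / 2 := by
      linarith [sq_nonneg y, mul_le_mul_of_nonneg_left hq8 hy0]
    have h3 := mul_le_mul_of_nonneg_left h2 (show 0 ≤ 1 - γ by linarith)
    have h4 := mul_le_mul_of_nonneg_right hγ1 hy0
    linarith
  have hβy : |β| ≤ lam * Real.exp y := by
    have h1 : y + 1 ≤ Real.exp y := Real.add_one_le_exp y
    have h2 : |β| ≤ lam * (y + 1) := by
      have : lam * y = lam * g * (|β| - lam) := by rw [hy]; ring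
      have h3 : |β| - lam ≤ lam * g * (|β| - lam) :=
        le_mul_of_one_le_left (by linarith) (by linarith)
      linarith
    exact h2.trans (by gcongr)
  calc |β| ^ 2 * Real.exp (-(noiseThreshold n p s lam α δ β ^ 2 / (2 * (1 + 4 * α) ^ 2)))
      ≤ (lam * Real.exp y) ^ 2 * Real.exp (-((1 - γ) * (y / 2 + q) ^ 2 / 2)) := by
        gcongr
    _ = lam ^ 2 * Real.exp (2 * y - (1 - γ) * (y / 2 + q) ^ 2 / 2) := by
        rw [mul_pow, mul_assoc, ← Real.exp_nat_mul, ← Real.exp_add]; push_cast; rfl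
    _ ≤ _ := by
        gcongr
        linarith

/-- The bound on the conditional expectation of the oracle loss, for `γ = 10 (α + δ)`. -/
lemma sum_oracle_tail_le {n p s : ℕ} {lam α δ γ : ℝ} {z : Fin p → SignType} {β : Fin p → ℝ}
    (hn : 0 < n) (hlam : 0 < lam)
    (hs : 1 ≤ s) (hsp : 2 * s < p) (hα : 0 ≤ α) (hδ : 0 ≤ δ) (hγ : γ = 10 * (α + δ))
    (hγ1 : γ ≤ 1 / 2) (hp : 1 ≤ Real.log p) (hγp : γ * Real.log p ≤ 1)
    (hsnr : 20 ≤ snr n p s lam) (hz : z ∈ signPatterns p s) (hβ : β ∈ coeffSpace z lam) :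
    (∀ j, 0 ≤ noiseThreshold n p s lam α δ (β j)) ∧
    ∑ j, 8 * n * max |β j| lam ^ 2 *
      (2 * Real.exp (-(noiseThreshold n p s lam α δ (β j) ^ 2 / (2 * (1 + 4 * α) ^ 2))))
      ≤ s * n * lam ^ 2 * Real.exp (-((1 - 3 * γ) * snr n p s lam ^ 2 / 2)
          + 2 * (γ * Real.log p) * snr n p s lam + γ * Real.log p + 4) := by
  classical
  set Q := snr n p s lam with hQ
  obtain ⟨hnull0, hnull⟩ := noiseThreshold_zero_tail hn hlam hs hsp hα hδ hγ hγ1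
  have hsignal := fun j (hj : z j ≠ 0) => noiseThreshold_signal_tail (β := β j) hn hlam hs hsp hα hδ
    hγ hγ1 hp hγp hsnr (hβ.2 j hj)
  have hcard := card_signSupport hz
  have hγ0 : 0 ≤ γ := by rw [hγ]; positivity
  have hn' : (0 : ℝ) < n := by exact_mod_cast hn
  refine ⟨fun j => ?_, ?_⟩
  · by_cases hj : z j = 0
    · rw [eq_zero_of_mem_coeffSpace hβ hj]; exact hnull0
    · exact (hsignal j hj).1
  set A := Real.exp (-((1 - 3 * γ) * Q ^ 2 / 2) + 2 * (γ * Real.log p) * Q + γ * Real.log p)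
    with hA
  have hsplit := Finset.sum_add_sum_compl (signSupport z) fun j => 8 * n * max |β j| lam ^ 2 *
      (2 * Real.exp (-(noiseThreshold n p s lam α δ (β j) ^ 2 / (2 * (1 + 4 * α) ^ 2))))
  rw [← hsplit]
  have h1 : ∑ j ∈ signSupport z, 8 * n * max |β j| lam ^ 2 *
      (2 * Real.exp (-(noiseThreshold n p s lam α δ (β j) ^ 2 / (2 * (1 + 4 * α) ^ 2))))
      ≤ s * (16 * n * lam ^ 2 * A) := by
    refine (Finset.sum_le_card_nsmul _ _ (16 * n * lam ^ 2 * A) fun j hj => ?_).trans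
      (by rw [hcard, nsmul_eq_mul])
    have hzj := mem_signSupport.1 hj
    rw [max_eq_left (hβ.2 j hzj)]
    have h2 := (hsignal j hzj).2
    have h3 : Real.exp (-((1 - 3 * γ) * Q ^ 2 / 2) + 2 * (γ * Real.log p) * Q) ≤ A := by
      have := mul_nonneg hγ0 (zero_le_one.trans hp)
      exact Real.exp_le_exp.2 (by linarith)
    have h4 := h2.trans (mul_le_mul_of_nonneg_left h3 (sq_nonneg lam))
    have h5 := mul_le_mul_of_nonneg_left h4 (show (0 : ℝ) ≤ 16 * n by positivity)
    linarith
  have h2 : ∑ j ∈ (signSupport z)ᶜ, 8 * n * max |β j| lam ^ 2 *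
      (2 * Real.exp (-(noiseThreshold n p s lam α δ (β j) ^ 2 / (2 * (1 + 4 * α) ^ 2))))
      ≤ s * (16 * n * lam ^ 2 * A) := by
    have e : ∀ j ∈ (signSupport z)ᶜ, 8 * n * max |β j| lam ^ 2 *
        (2 * Real.exp (-(noiseThreshold n p s lam α δ (β j) ^ 2 / (2 * (1 + 4 * α) ^ 2))))
        = 16 * n * lam ^ 2 *
          Real.exp (-(noiseThreshold n p s lam α δ 0 ^ 2 / (2 * (1 + 4 * α) ^ 2))) := by
      intro j hj
      have hzj : z j = 0 := by simpa [mem_signSupport] using hj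
      rw [eq_zero_of_mem_coeffSpace hβ hzj, abs_zero, max_eq_right hlam.le]; ring
    rw [Finset.sum_congr rfl e, Finset.sum_const, Finset.card_compl, hcard, Fintype.card_fin,
      nsmul_eq_mul, Nat.cast_sub (by omega)]
    have h3 : Real.exp (-((1 - γ) * Q ^ 2 / 2) + γ * Real.log p) ≤ A := by
      have h4 := mul_nonneg hγ0 (zero_le_one.trans hp)
      refine Real.exp_le_exp.2 ?_
      linarith [mul_nonneg hγ0 (sq_nonneg Q), mul_nonneg h4 (show 0 ≤ Q by linarith)]
    have h4 := hnull.trans (mul_le_mul_of_nonneg_left h3 (Nat.cast_nonneg s))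
    have h5 := mul_le_mul_of_nonneg_left h4 (show (0 : ℝ) ≤ 16 * n * lam ^ 2 by positivity)
    linarith
  -- Signal and null coordinates each contribute a factor `16 = 8 * 2`; the summand 4 in the
  -- exponent absorbs their total.
  have he : 32 ≤ Real.exp 4 := by
    have h3 : (2.7 : ℝ) ≤ Real.exp 1 := by linarith [Real.exp_one_gt_d9]
    have h4 : Real.exp 4 = Real.exp 1 ^ 4 := by rw [← Real.exp_nat_mul]; norm_num
    rw [h4]
    calc (32 : ℝ) ≤ 2.7 ^ 4 := by norm_num
      _ ≤ _ := by gcongr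
  rw [Real.exp_add _ 4, ← hA]
  calc _ ≤ s * n * lam ^ 2 * (A * 32) := by linarith
    _ ≤ _ := by gcongr

/-- The union bound over the net is beaten by the concentration of a single norm. -/
lemma net_union_bound {n p s B : ℕ} {τ : ℝ} (hs : 1 ≤ s) (hsp : 2 * s < p)
    (hp : 1 ≤ Real.log p)
    (hτ : n * τ ^ 2 = (16 * ((2 * B + 2) * (18 * (2 * B + 2) + 2) + 2) : ℕ) * (s * Real.log p)) :
    ((p * (2 * (8 * ((2 * B + 2) * s)) + 1) + 1 : ℕ) : ℝ) ^ ((2 * B + 2) * s)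
      * (2 * Real.exp (-(n * τ ^ 2 / 16))) ≤ 1 / p := by
  have hp0 : (0 : ℝ) < p := by exact_mod_cast (by omega : 0 < p)
  have hs' : (1 : ℝ) ≤ s := by exact_mod_cast hs
  set D : ℕ := 18 * (2 * B + 2) with hD
  set l := Real.log p with hl
  have hpe : (p : ℝ) = Real.exp l := (Real.exp_log hp0).symm
  have hbase : ((p * (2 * (8 * ((2 * B + 2) * s)) + 1) + 1 : ℕ) : ℝ) ≤ Real.exp ((D + 2) * l) := by
    have h1 : p * (2 * (8 * ((2 * B + 2) * s)) + 1) + 1 ≤ D * p ^ 2 := by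
      have h2 : (2 * B + 2) * s ≤ (2 * B + 2) * p := Nat.mul_le_mul_left _ (by omega)
      have h3 : p * (2 * (8 * ((2 * B + 2) * s)) + 1) + 1
          ≤ p * (16 * ((2 * B + 2) * p) + 1) + 1 :=
        Nat.add_le_add_right (Nat.mul_le_mul_left p (by linarith)) 1
      have h4 : 1 ≤ p ^ 2 := Nat.one_le_pow _ _ (by omega)
      have h5 : p ≤ p ^ 2 := Nat.le_self_pow (by norm_num) p
      have h6 : p * (16 * ((2 * B + 2) * p) + 1) + 1 = 16 * (2 * B + 2) * p ^ 2 + p + 1 := by ring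
      have h7 : D * p ^ 2 = 16 * (2 * B + 2) * p ^ 2 + 4 * (B * p ^ 2) + 4 * p ^ 2 := by
        rw [hD]; ring
      have h8 := Nat.zero_le (B * p ^ 2)
      omega
    have h2 : ((p * (2 * (8 * ((2 * B + 2) * s)) + 1) + 1 : ℕ) : ℝ) ≤ D * (p : ℝ) ^ 2 := by
      exact_mod_cast h1
    refine h2.trans ?_
    have h3 : (D : ℝ) ≤ Real.exp (D * l) := by
      have h4 := Real.add_one_le_exp (D * l)
      have h5 : (D : ℝ) ≤ D * l := le_mul_of_one_le_right (Nat.cast_nonneg _) hp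
      linarith
    calc (D : ℝ) * (p : ℝ) ^ 2 ≤ Real.exp (D * l) * Real.exp l ^ 2 := by rw [hpe]; gcongr
      _ = Real.exp ((D + 2) * l) := by
        rw [← Real.exp_nat_mul, ← Real.exp_add]; congr 1; push_cast; ring
  have h2 : (2 : ℝ) ≤ Real.exp l := by linarith [Real.add_one_le_exp l]
  have e1 : (1 : ℝ) / p = Real.exp (-l) := by rw [hpe, Real.exp_neg, one_div]
  rw [e1, hτ]
  -- The net has at most `exp ((2B + 2)(D + 2) s l)` points, and `n τ² / 16` exceeds this exponent
  -- by `2 s l`. One `l` pays for the factor 2, and at least another is left since `s ≥ 1`.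
  calc _ ≤ Real.exp ((D + 2) * l) ^ ((2 * B + 2) * s) * (Real.exp l * Real.exp (-(((16 *
        ((2 * B + 2) * (D + 2) + 2) : ℕ) : ℝ) * (s * l) / 16))) := by gcongr
    _ = Real.exp (l - 2 * (s * l)) := by
        rw [← Real.exp_nat_mul, ← Real.exp_add, ← Real.exp_add]
        congr 1; push_cast; ring
    _ ≤ Real.exp (-l) := by
        gcongr
        nlinarith

end Numerics

/-! ### All steps of a run, and the statement at fixed sizes. -/

section Main

/-- On the good event every step of a run contracts the loss. -/
lemma forall_loss_le_of_good {n p s B : ℕ} {lam α δ M r : ℝ} {X : Matrix (Fin n) (Fin p) ℝ}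
    {w : Fin n → ℝ} {z : ℕ → Fin p → SignType} {zstar : Fin p → SignType} {β : Fin p → ℝ}
    (hn : 0 < n) (hlam : 0 < lam) (hδ0 : 0 < δ) (hδ : δ ≤ 1 / 4) (hα0 : 0 ≤ α) (hα : α ≤ 1 / 2)
    (hL : 0 ≤ Real.log (((p : ℝ) - (s : ℝ)) / (s : ℝ)))
    (hs : 1 ≤ s) (hB : 2 ≤ B) (hRI : RestrictedIsometry X ((2 * B + 2) * s) α)
    (hz : zstar ∈ signPatterns p s) (hβ : β ∈ coeffSpace zstar lam)
    (hnl : 1 ≤ n * lam ^ 2) (hM1 : 1 ≤ M ^ 2)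
    (hW : ∀ j, |noiseDir X (signSupport zstar) j ⬝ᵥ w| ≤ M)
    (hsmall : 8192 * B * α ^ 2 * M ^ 2 ≤ δ ^ 2) (hr : r ≤ 1)
    (horacle : oracleLoss s lam α δ β (signSupport zstar) X w ≤ s * n * lam ^ 2 * r)
    (hrun : IsRun s lam X (response X β w) z)
    (hinit : loss lam X β (z 0) zstar ≤ B * s * n * lam ^ 2) (t : ℕ) (ht : 1 ≤ t) :
    loss lam X β (z t) zstar ≤ s * n * lam ^ 2 * r + 1 / 2 * loss lam X β (z (t - 1)) zstar := by
  have hB' : (2 : ℝ) ≤ B := by exact_mod_cast hB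
  have hstep : ∀ t : ℕ, loss lam X β (z t) zstar ≤ B * s * n * lam ^ 2 →
      loss lam X β (z (t + 1)) zstar
        ≤ s * n * lam ^ 2 * r + 1 / 2 * loss lam X β (z t) zstar := by
    intro t hloss
    obtain ⟨b, hb, hzt⟩ := hrun (t + 1) (by omega)
    rw [Nat.add_sub_cancel] at hb
    rw [hzt]
    have := loss_thresholdStep_le hn hlam hδ0 hδ hα0 hα hL hs (by omega) le_rfl hRI hz hβ hnl hM1
      hW hsmall hloss hb
    linarith
  -- The region is invariant: `1 + B / 2 ≤ B` because `B ≥ 2`, which is why `B` may have to exceed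
  -- the initial constant.
  have hall : ∀ t : ℕ, loss lam X β (z t) zstar ≤ B * s * n * lam ^ 2 := by
    intro t
    induction t with
    | zero => exact hinit
    | succ t ih =>
      refine (hstep t ih).trans ?_
      have h0 : (0 : ℝ) ≤ s * n * lam ^ 2 := by positivity
      have h1 := mul_le_mul_of_nonneg_left hr h0
      have h2 := mul_le_mul_of_nonneg_right hB' h0
      linarith
  obtain ⟨t, rfl⟩ : ∃ u, t = u + 1 := ⟨t - 1, by omega⟩
  rw [Nat.add_sub_cancel]
  exact hstep t (hall t)

/-- The union bound over the coordinates is beaten by the Gaussian tail at the level `M`. -/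
lemma noise_union_bound {p : ℕ} {M σ : ℝ} (hp0 : 0 < p) (hp : 1 ≤ Real.log p) (hσ0 : 0 < σ)
    (hσ : σ ≤ 7 / 5) (hM2 : M ^ 2 = 16 * Real.log p) :
    p * (2 * Real.exp (-(M ^ 2 / (2 * σ ^ 2)))) ≤ 1 / p := by
  set l := Real.log p with hl
  have hpe : (p : ℝ) = Real.exp l := (Real.exp_log (by exact_mod_cast hp0)).symm
  have h2 : (2 : ℝ) ≤ Real.exp l := by linarith [Real.add_one_le_exp l]
  have h3 : 4 * l ≤ M ^ 2 / (2 * σ ^ 2) := by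
    rw [hM2, le_div_iff₀ (by positivity)]
    have h4 : σ ^ 2 ≤ (7 / 5) ^ 2 := pow_le_pow_left₀ hσ0.le hσ 2
    have h5 := mul_le_mul_of_nonneg_left h4 (show 0 ≤ l by linarith)
    linarith
  calc p * (2 * Real.exp (-(M ^ 2 / (2 * σ ^ 2))))
      ≤ Real.exp l * (Real.exp l * Real.exp (-(4 * l))) := by
        rw [hpe]; gcongr
    _ = Real.exp (-(2 * l)) := by rw [← Real.exp_add, ← Real.exp_add]; congr 1; ring
    _ ≤ Real.exp (-l) := Real.exp_le_exp.2 (by linarith)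
    _ = 1 / p := by rw [Real.exp_neg, ← hpe, one_div]

/-- The contraction of the loss along a run at fixed sample size, dimension and sparsity. -/
lemma measureReal_not_contract_le {n p s B : ℕ} {lam τ δ γ ε C₀ η : ℝ} {zstar : Fin p → SignType}
    {β : Fin p → ℝ} {Ω : Type*} [MeasurableSpace Ω] {P : Measure Ω} [IsProbabilityMeasure P]
    {X : Ω → Matrix (Fin n) (Fin p) ℝ} {w : Ω → Fin n → ℝ} {z : Ω → ℕ → Fin p → SignType}
    (hn : 0 < n) (hlam : 0 < lam) (hs : 1 ≤ s) (hsp : 2 * s < p) (hp : 1 ≤ Real.log p)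
    (hB : 2 ≤ B) (hC : C₀ ≤ B) (hτ0 : 0 < τ)
    (hτ : n * τ ^ 2 = (16 * ((2 * B + 2) * (18 * (2 * B + 2) + 2) + 2) : ℕ) * (s * Real.log p))
    (hδ0 : 0 < δ) (hγ : γ = 10 * (2 * τ + δ)) (hγ1 : γ ≤ 1 / 2) (hγp : γ * Real.log p ≤ 1)
    (hsnr : 20 ≤ snr n p s lam)
    (hsmall : 8192 * B * (2 * τ) ^ 2 * (16 * Real.log p) ≤ δ ^ 2) (hε0 : 0 ≤ 1 + ε)
    (hε : (1 + ε) * snr n p s lam ^ 2 / 2 = (1 - 3 * γ) * snr n p s lam ^ 2 / 2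
      - 2 * (γ * Real.log p) * snr n p s lam - γ * Real.log p - 4 - snr n p s lam)
    (hz : zstar ∈ signPatterns p s) (hβ : β ∈ coeffSpace zstar lam)
    (hdesign : IsGaussianDesign P X w)
    (hrun : ∀ ω, IsRun s lam (X ω) (response (X ω) β (w ω)) (z ω))
    (hinit : P.real {ω | ¬ (loss lam (X ω) β (z ω 0) zstar ≤ C₀ * s * n * lam ^ 2)} ≤ η) :
    P.real {ω | ¬ ∀ t : ℕ, 1 ≤ t → loss lam (X ω) β (z ω t) zstar
        ≤ s * n * lam ^ 2 * Real.exp (-((1 + ε) * snr n p s lam ^ 2 / 2))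
          + 1 / 2 * loss lam (X ω) β (z ω (t - 1)) zstar}
      ≤ η + Real.exp (-snr n p s lam) + 2 / p := by
  have hn' : (0 : ℝ) < n := by exact_mod_cast hn
  have hs' : (1 : ℝ) ≤ s := by exact_mod_cast hs
  have hsp' : (2 : ℝ) * s < p := by exact_mod_cast hsp
  have hp0 : (0 : ℝ) < p := by linarith
  set Q := snr n p s lam with hQ
  set l := Real.log p with hl
  have hquot : 1 ≤ ((p : ℝ) - s) / s := by rw [le_div_iff₀ (by linarith)]; linarith
  have hL : 0 ≤ Real.log (((p : ℝ) - s) / s) := Real.log_nonneg hquot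
  have hnl : 1 ≤ n * lam ^ 2 := by
    have h1 : 0 ≤ Real.log (((p : ℝ) - s) / s) / (lam * √(n : ℝ)) := by positivity
    have h2 : Q = lam * √(n : ℝ) / 2 - Real.log (((p : ℝ) - s) / s) / (lam * √(n : ℝ)) := rfl
    have h3 : 1 ≤ lam * √(n : ℝ) := by linarith
    have h4 : n * lam ^ 2 = (lam * √(n : ℝ)) ^ 2 := by
      rw [mul_pow, Real.sq_sqrt hn'.le]; ring
    rw [h4]
    exact one_le_pow₀ h3
  set M := 4 * √l with hM
  have hM2 : M ^ 2 = 16 * l := by rw [hM, mul_pow, Real.sq_sqrt (by linarith)]; norm_num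
  set r := Real.exp (-((1 + ε) * Q ^ 2 / 2)) with hr
  have hr1 : r ≤ 1 := by
    rw [hr]
    exact Real.exp_le_one_iff.2 (by have := mul_nonneg hε0 (sq_nonneg Q); linarith)
  obtain ⟨hthr, hsum⟩ := sum_oracle_tail_le (α := 2 * τ) hn hlam hs hsp (by linarith) hδ0.le hγ hγ1
    hp hγp hsnr hz hβ
  -- `hε` reserves a full `Q` in the exponent, to be spent as `exp (-Q)` in Markov's inequality.
  have hsum' := hsum.trans (le_of_eq (show _ = Real.exp (-Q) * (s * n * lam ^ 2 * r) by
    rw [mul_left_comm (Real.exp (-Q)), hr, ← Real.exp_add, hε]; congr 2; ring))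
  have hgood := hdesign.measureReal_not_good_le (m := (2 * B + 2) * s) (S := signSupport zstar)
    (M := M) hn hτ0 (by linarith) (by positivity)
    (by rw [card_signSupport hz]; nlinarith) hthr (by positivity) hsum'
  have hnet := net_union_bound (B := B) hs hsp hp hτ
  have hW := noise_union_bound (p := p) (σ := 1 + 4 * (2 * τ)) (by omega) hp (by linarith)
    (by linarith) hM2
  -- The second event involves only `X`, `w` and the true support, so it serves all `t` at once and
  -- any data-dependent start. The run need not be measurable, since the inclusion of sets suffices.
  have hsub : {ω | ¬ ∀ t : ℕ, 1 ≤ t → loss lam (X ω) β (z ω t) zstar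
        ≤ s * n * lam ^ 2 * r + 1 / 2 * loss lam (X ω) β (z ω (t - 1)) zstar}
      ⊆ {ω | ¬ (loss lam (X ω) β (z ω 0) zstar ≤ C₀ * s * n * lam ^ 2)} ∪
        {ω | ¬ (RestrictedIsometry (X ω) ((2 * B + 2) * s) (2 * τ) ∧
          (∀ j, |noiseDir (X ω) (signSupport zstar) j ⬝ᵥ w ω| ≤ M) ∧
          oracleLoss s lam (2 * τ) δ β (signSupport zstar) (X ω) (w ω)
            ≤ s * n * lam ^ 2 * r)} := by
    intro ω hω
    simp only [Set.mem_ofPred_eq, Set.mem_union] at hω ⊢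
    by_contra hcon
    simp only [not_or, not_not] at hcon
    obtain ⟨h1, h2, h3, h4⟩ := hcon
    refine hω (forall_loss_le_of_good hn hlam hδ0 (by linarith) (by linarith) (by linarith) hL hs
      hB h2 hz hβ hnl (by rw [hM2]; linarith) h3 (by rw [hM2]; exact hsmall) hr1 h4 (hrun ω)
      (h1.trans ?_))
    gcongr
  have hfin := (measureReal_mono hsub (measure_ne_top P _)).trans (measureReal_union_le _ _)
  have e : (2 : ℝ) / p = 1 / p + 1 / p := by ring
  rw [e]
  linarith

end Main

end SignRecovery
-- Asymptotic choice of the parameters.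
theorem theorem5 (n p s : ℕ → ℕ) (lam : ℕ → ℝ)
    (hs_pos : ∀ k, 1 ≤ s k) (hs_le : ∀ k, s k ≤ p k) (hlam : ∀ k, 0 < lam k)
    (hsp : limsup (fun k => (s k : ℝ) / (p k : ℝ)) atTop < 1 / 2)
    (hsn : (fun k => (s k : ℝ) * Real.log (p k : ℝ) ^ 4) =o[atTop] fun k => (n k : ℝ))
    (hsnr : Tendsto (fun k => SignRecovery.snr (n k) (p k) (s k) (lam k)) atTop atTop)
    (C₀ : ℝ) (hC₀ : 0 < C₀) :
    ∃ ε : ℕ → ℝ, Tendsto ε atTop (𝓝 0) ∧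
      ∀ᶠ k in atTop,
        ∀ zstar ∈ SignRecovery.signPatterns (p k) (s k),
        ∀ βstar ∈ SignRecovery.coeffSpace zstar (lam k),
        ∀ (Ω : Type*) [MeasurableSpace Ω] (P : Measure Ω) [IsProbabilityMeasure P]
          (X : Ω → Matrix (Fin (n k)) (Fin (p k)) ℝ) (w : Ω → Fin (n k) → ℝ)
          (z : Ω → ℕ → Fin (p k) → SignType) (η : ℝ),
          SignRecovery.IsGaussianDesign P X w →
          (∀ ω, SignRecovery.IsRun (s k) (lam k) (X ω)
            (SignRecovery.response (X ω) βstar (w ω)) (z ω)) →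
          P.real {ω | ¬ (SignRecovery.loss (lam k) (X ω) βstar (z ω 0) zstar
            ≤ C₀ * (s k : ℝ) * (n k : ℝ) * lam k ^ 2)} ≤ η →
          P.real {ω | ¬ ∀ t : ℕ, 1 ≤ t →
              SignRecovery.loss (lam k) (X ω) βstar (z ω t) zstar
                ≤ (s k : ℝ) * (n k : ℝ) * lam k ^ 2
                    * Real.exp (-((1 + ε k)
                        * SignRecovery.snr (n k) (p k) (s k) (lam k) ^ 2 / 2))
                  + 1 / 2 * SignRecovery.loss (lam k) (X ω) βstar (z ω (t - 1)) zstar}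
            ≤ η + Real.exp (-SignRecovery.snr (n k) (p k) (s k) (lam k)) + 2 / (p k : ℝ) := by
  obtain ⟨B, hB⟩ : ∃ B : ℕ, B = max ⌈C₀⌉₊ 2 := ⟨_, rfl⟩
  have hB2 : 2 ≤ B := hB ▸ le_max_right _ _
  have hCB : C₀ ≤ B := (Nat.le_ceil C₀).trans (by rw [hB]; exact_mod_cast le_max_left _ _)
  obtain ⟨c, hc⟩ : ∃ c : ℕ, c = 16 * ((2 * B + 2) * (18 * (2 * B + 2) + 2) + 2) := ⟨_, rfl⟩
  have hc0 : (0 : ℝ) < c := by rw [hc]; positivity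
  set l : ℕ → ℝ := fun k => Real.log (p k) with hl
  -- `τ` is forced by the union bound over the net, so `τ² l³ = c κ`. The contraction needs `τ² l ≪
  -- δ²` and the tails need `δ l → 0`; with `δ = κ^(1/4) / l` the first reads `κ ≪ √κ` and the
  -- second `κ^(1/4) → 0`.
  set κ : ℕ → ℝ := fun k => s k * l k ^ 4 / n k with hκ
  set τ : ℕ → ℝ := fun k => √(c * (s k * l k) / n k) with hτ
  set δ : ℕ → ℝ := fun k => √√(κ k) / l k with hδ
  set γ : ℕ → ℝ := fun k => 10 * (2 * τ k + δ k) with hγ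
  set Q : ℕ → ℝ := fun k => SignRecovery.snr (n k) (p k) (s k) (lam k) with hQ
  have hκ0 : Tendsto κ atTop (𝓝 0) := hsn.tendsto_div_nhds_zero
  have hp3 : ∀ᶠ k in atTop, 2 * s k < p k := by
    -- A real `limsup` bounds the sequence eventually only when the sequence is bounded above; here
    -- `s ≤ p` provides this.
    have hbdd : IsBoundedUnder (· ≤ ·) atTop fun k => (s k : ℝ) / (p k : ℝ) :=
      isBoundedUnder_of ⟨1, fun k => div_le_one_of_le₀ (by exact_mod_cast hs_le k) (by positivity)⟩
    filter_upwards [eventually_lt_of_limsup_lt hsp hbdd] with k hk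
    have hp0 : (0 : ℝ) < p k := by exact_mod_cast (hs_pos k).trans (hs_le k)
    rw [div_lt_iff₀ hp0] at hk
    have : (2 : ℝ) * s k < p k := by linarith
    exact_mod_cast this
  have hl1 : ∀ᶠ k in atTop, 1 ≤ l k := by
    filter_upwards [hp3] with k hk
    have h3 : (3 : ℝ) ≤ p k := by
      have := hs_pos k
      exact_mod_cast (by omega : 3 ≤ p k)
    rw [hl, Real.le_log_iff_exp_le (by linarith)]
    linarith [Real.exp_one_lt_d9]
  have hn0 : ∀ᶠ k in atTop, 0 < n k := by
    filter_upwards [hl1, hsn.def one_pos] with k hk hk'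
    have h1 : (1 : ℝ) ≤ s k := by exact_mod_cast hs_pos k
    have h2 : 1 ≤ (s k : ℝ) * l k ^ 4 := one_le_mul_of_one_le_of_one_le h1 (one_le_pow₀ hk)
    have h3 : (s k : ℝ) * l k ^ 4 ≤ n k := by
      have := (le_abs_self _).trans hk'
      simpa using this
    exact_mod_cast (show (0 : ℝ) < n k by linarith)
  have hτsq : ∀ᶠ k in atTop, n k * τ k ^ 2 = c * (s k * l k) ∧ 0 < τ k ∧ 0 < κ k ∧ 0 < δ k ∧
      τ k ^ 2 * l k * l k ^ 2 = c * κ k := by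
    filter_upwards [hl1, hn0] with k hk hk'
    have h1 : (1 : ℝ) ≤ s k := by exact_mod_cast hs_pos k
    have h2 : (0 : ℝ) < n k := by exact_mod_cast hk'
    have h3 : τ k ^ 2 = c * (s k * l k) / n k := Real.sq_sqrt (by positivity)
    have h4 : 0 < κ k := by simp only [hκ]; positivity
    refine ⟨by rw [h3]; field_simp, Real.sqrt_pos.2 (by positivity), h4,
      div_pos (Real.sqrt_pos.2 (Real.sqrt_pos.2 h4)) (by linarith), ?_⟩
    rw [h3]; simp only [hκ]; ring
  have hγl : Tendsto (fun k => γ k * l k) atTop (𝓝 0) := by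
    have hlim : Tendsto (fun k => 10 * (2 * √(c * κ k) + √√(κ k))) atTop (𝓝 0) := by
      have h1 : Tendsto (fun k => √(c * κ k)) atTop (𝓝 0) := by
        have := (Real.continuous_sqrt.tendsto _).comp (hκ0.const_mul (c : ℝ))
        simpa only [Function.comp_def, mul_zero, Real.sqrt_zero] using this
      have h2 : Tendsto (fun k => √√(κ k)) atTop (𝓝 0) := by
        have := ((Real.continuous_sqrt.comp Real.continuous_sqrt).tendsto 0).comp hκ0
        simpa only [Function.comp_def, Real.sqrt_zero] using this
      simpa using ((h1.const_mul 2).add h2).const_mul 10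
    refine squeeze_zero' ?_ ?_ hlim
    · filter_upwards [hl1, hτsq] with k hk ⟨_, h1, _, h2, _⟩
      simp only [hγ]; positivity
    · filter_upwards [hl1, hτsq] with k hk ⟨_, h1, h3, h2, h4⟩
      have hτl : τ k * l k ≤ √(c * κ k) := by
        refine Real.le_sqrt_of_sq_le ?_
        rw [← h4, mul_pow]
        nlinarith [mul_nonneg (sq_nonneg (τ k)) (sq_nonneg (l k))]
      have hδl : δ k * l k = √√(κ k) := by
        simp only [hδ]; field_simp
      have : γ k * l k = 10 * (2 * (τ k * l k) + δ k * l k) := by simp only [hγ]; ring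
      rw [this, hδl]
      linarith
  have hγ0 : Tendsto γ atTop (𝓝 0) := by
    refine squeeze_zero' ?_ ?_ hγl
    · filter_upwards [hτsq] with k ⟨_, h1, _, h2, _⟩
      simp only [hγ]; positivity
    · filter_upwards [hl1, hτsq] with k hk ⟨_, h1, _, h2, _⟩
      exact le_mul_of_one_le_right (by simp only [hγ]; positivity) hk
  -- The solution of the equation `hε` of `measureReal_not_contract_le`: all losses in the exponent,
  -- including the `Q` for Markov's inequality, divided by `Q² / 2`.
  set ε : ℕ → ℝ := fun k => -3 * γ k - (4 * (γ k * l k) + 2) / Q k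
    - (2 * (γ k * l k) + 8) / Q k ^ 2 with hε
  have hε0 : Tendsto ε atTop (𝓝 0) := by
    have h1 := ((hγl.const_mul 4).add_const 2).div_atTop hsnr
    have h2 := ((hγl.const_mul 2).add_const 8).div_atTop
      ((tendsto_pow_atTop two_ne_zero).comp hsnr)
    have h3 := ((hγ0.const_mul (-3)).sub h1).sub h2
    rw [mul_zero, sub_zero, sub_zero] at h3
    exact h3
  refine ⟨ε, hε0, ?_⟩
  have hsmall : ∀ᶠ k in atTop, 524288 * B * c * √(κ k) ≤ 1 := by
    have h1 : Tendsto (fun k => 524288 * B * c * √(κ k)) atTop (𝓝 0) := by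
      have := ((Real.continuous_sqrt.tendsto _).comp hκ0).const_mul (524288 * B * c : ℝ)
      simpa using this
    exact h1.eventually_le_const one_pos
  filter_upwards [hp3, hl1, hn0, hτsq, hsmall, hγ0.eventually_le_const (show (0 : ℝ) < 1 / 2 by
    norm_num), hγl.eventually_le_const one_pos, hsnr.eventually_ge_atTop 20,
    hε0.eventually_const_le (show (-1 : ℝ) < 0 by norm_num)]
    with k hk1 hk2 hk3 ⟨hk4, hk5, hk6, hk7, hk8⟩ hk9 hk10 hk11 hk12 hk13
  intro zstar hz β hβ Ω _ P _ X w z η hdesign hrun hinit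
  refine SignRecovery.measureReal_not_contract_le (γ := γ k) (τ := τ k) (δ := δ k) hk3 (hlam k)
    (hs_pos k) hk1 hk2 hB2 hCB hk5 (by rw [hk4, hc]) hk7 rfl hk10 hk11 hk12 ?_ (by linarith) ?_
    hz hβ hdesign hrun hinit
  · have h1 : δ k ^ 2 * l k ^ 2 = √(κ k) := by
      simp only [hδ]
      rw [div_pow, Real.sq_sqrt (Real.sqrt_nonneg _)]
      field_simp
    refine le_of_mul_le_mul_right ?_ (show 0 < l k ^ 2 by positivity)
    rw [h1]
    calc 8192 * B * (2 * τ k) ^ 2 * (16 * Real.log (p k)) * l k ^ 2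
        = 524288 * B * (τ k ^ 2 * l k * l k ^ 2) := by simp only [hl]; ring
      _ = 524288 * B * c * √(κ k) * √(κ k) := by
        rw [hk8]; nth_rewrite 1 [← Real.mul_self_sqrt hk6.le]; ring
      _ ≤ 1 * √(κ k) := by gcongr
      _ = √(κ k) := one_mul _
  · have hQ0 : Q k ≠ 0 := by have : 20 ≤ Q k := hk12; linarith
    change (1 + ε k) * Q k ^ 2 / 2 = (1 - 3 * γ k) * Q k ^ 2 / 2 - 2 * (γ k * l k) * Q k
      - γ k * l k - 4 - Q k
    simp only [hε]
    field_simp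
    ring
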